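/- Let $\mathbb D$ be the open unit disc. For $1<p<\infty$ and $s\in\mathbb R$ let $D^p_s$ be the space of analytic functions $f:\mathbb D\to\mathbb C$ with $\int_{\mathbb D}|f'(z)|^p(1-|z|^2)^s\,dA(z)<\infty$, where $dA$ is Lebesgue area measure, normed by $$\|f\|_{D^p_s}=|f(0)|+\Big(\int_{\mathbb D}|f'(z)|^p(1-|z|^2)^s\,dA(z)\Big)^{1/p}.$$ A semigroup on $\mathbb D$ is a family $(\varphi_t)_{t\ge 0}$ of analytic maps $\varphi_t:\mathbb D\to\mathbb D$ with $\varphi_0(z)=z$, $\varphi_t\circ\varphi_s=\varphi_{s+t}$ for all $s,t\ge 0$, and $\varphi_t(z)\to z$ uniformly on compact subsets of $\mathbb D$ as $t\to0^+$. Let $1<p<\infty$ and suppose that either $p\ge 2$ and $s\ge p-2$, or $p<2$ and $s\ge 0$. Then for every semigroup $(\varphi_t)_{t\ge0}$ on $\mathbb D$ the formula $C_tf=f\circ\varphi_t$ defines a strongly continuous semigroup of bounded linear operators on $D^p_s$: each $C_t$ maps $D^p_s$ into itself and is bounded, $C_0$ is the identity, $C_{t+s}=C_tC_s$ for all $t,s\ge0$,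 and $\lim_{t\to0^+}\|C_tf-f\|_{D^p_s}=0$ for every $f\in D^p_s$. In particular ($p=2$, $s=0$) this contains the result for the classical Dirichlet space. -/

import Mathlib

open MeasureTheory Filter Topology
open scoped NNReal Complex.UnitDisc

namespace HoloDisc

/-- The extension by zero to `ℂ` of a function on the open unit disc. It is only used on the disc,
to speak of complex derivatives there. -/
noncomputable def ext (f : 𝔻 → ℂ) (z : ℂ) : ℂ :=
  if hz : ‖z‖ < 1 then f (Complex.UnitDisc.mk z hz) else 0

/-- `f` is analytic on the unit disc. -/
def IsHolo (f : 𝔻 → ℂ) : Prop :=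
  DifferentiableOn ℂ (ext f) (Metric.ball 0 1)

/-- A semigroup of holomorphic self-maps of the unit disc. -/
structure IsHolomorphicSemigroup (φ : ℝ≥0 → 𝔻 → 𝔻) : Prop where
  holo : ∀ t, IsHolo (fun z => (φ t z : ℂ))
  zero : ∀ z, φ 0 z = z
  comp : ∀ t s z, φ t (φ s z) = φ (s + t) z
  tendsto : ∀ K : Set 𝔻, IsCompact K →
    TendstoUniformlyOn (fun t z => (φ t z : ℂ)) (fun z => (z : ℂ)) (𝓝[>] 0) K

/-- A strongly continuous semigroup of bounded operators. -/
structure IsStronglyContinuousSemigroup {X : Type*} [NormedAddCommGroup X] [NormedSpace ℂ X]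
    (T : ℝ≥0 → X →L[ℂ] X) : Prop where
  zero : T 0 = ContinuousLinearMap.id ℂ X
  add : ∀ t s, T (t + s) = (T t).comp (T s)
  tendsto : ∀ x, Tendsto (fun t => ‖T t x - x‖) (𝓝[>] 0) (𝓝 0)

/-- The integrand `|f'(z)|^p (1 - |z|²)^s`. -/
noncomputable def dirichletIntegrand (p s : ℝ) (f : 𝔻 → ℂ) (z : ℂ) : ℝ :=
  ‖deriv (ext f) z‖ ^ p * (1 - ‖z‖ ^ 2) ^ s

/-- `f` is analytic on the disc and `∫_𝔻 |f'|^p (1 - |z|²)^s dA < ∞`. -/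
def MemDirichlet (p s : ℝ) (f : 𝔻 → ℂ) : Prop :=
  IsHolo f ∧ IntegrableOn (dirichletIntegrand p s f) (Metric.ball 0 1)

/-- The norm `|f(0)| + (∫_𝔻 |f'|^p (1 - |z|²)^s dA)^{1/p}`. -/
noncomputable def dirichletNorm (p s : ℝ) (f : 𝔻 → ℂ) : ℝ :=
  ‖f 0‖ + (∫ z in Metric.ball (0 : ℂ) 1, dirichletIntegrand p s f z) ^ (1 / p)

/-! Facts needed to see that these functions form a normed space. -/

theorem ext_coe (f : 𝔻 → ℂ) (z : 𝔻) : ext f z = f z := by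
  simp [ext, z.norm_lt_one]

theorem ext_zero_fun : ext (0 : 𝔻 → ℂ) = 0 := by
  funext z; simp [ext]

theorem ext_add (f g : 𝔻 → ℂ) : ext (f + g) = ext f + ext g := by
  funext z; by_cases hz : ‖z‖ < 1 <;> simp [ext, hz]

theorem ext_smul (c : ℂ) (f : 𝔻 → ℂ) : ext (c • f) = c • ext f := by
  funext z; by_cases hz : ‖z‖ < 1 <;> simp [ext, hz]

theorem IsHolo.differentiableAt {f : 𝔻 → ℂ} (hf : IsHolo f) {z : ℂ}
    (hz : z ∈ Metric.ball (0 : ℂ) 1) : DifferentiableAt ℂ (ext f) z :=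
  DifferentiableOn.differentiableAt hf (Metric.isOpen_ball.mem_nhds hz)

theorem weight_pos {z : ℂ} (hz : z ∈ Metric.ball (0 : ℂ) 1) : 0 < 1 - ‖z‖ ^ 2 := by
  have h : ‖z‖ < 1 := by simpa using hz
  nlinarith [norm_nonneg z]

/-- `f'` times a power of the weight, so that its `p`-th power is the integrand. -/
noncomputable def weightedDeriv (p s : ℝ) (f : 𝔻 → ℂ) (z : ℂ) : ℂ :=
  (((1 - ‖z‖ ^ 2) ^ (s / p) : ℝ) : ℂ) * deriv (ext f) z

theorem norm_weightedDeriv {p : ℝ} (hp : 1 < p) (s : ℝ) (f : 𝔻 → ℂ) {z : ℂ}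
    (hz : z ∈ Metric.ball (0 : ℂ) 1) :
    ‖weightedDeriv p s f z‖ ^ p = dirichletIntegrand p s f z := by
  have hw := weight_pos hz
  have h1 : 0 ≤ (1 - ‖z‖ ^ 2) ^ (s / p) := (Real.rpow_pos_of_pos hw _).le
  rw [weightedDeriv, dirichletIntegrand, norm_mul, Complex.norm_real, Real.norm_of_nonneg h1,
    Real.mul_rpow h1 (norm_nonneg _), ← Real.rpow_mul hw.le, div_mul_cancel₀ s (by linarith),
    mul_comm]

theorem measurable_weightedDeriv (p s : ℝ) (f : 𝔻 → ℂ) : Measurable (weightedDeriv p s f) := by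
  unfold weightedDeriv
  have := measurable_deriv (ext f)
  fun_prop

theorem integrableOn_iff_memLp {p : ℝ} (hp : 1 < p) (s : ℝ) (f : 𝔻 → ℂ) :
    IntegrableOn (dirichletIntegrand p s f) (Metric.ball 0 1) ↔
      MemLp (weightedDeriv p s f) (ENNReal.ofReal p)
        (volume.restrict (Metric.ball (0 : ℂ) 1)) := by
  have hp0 : 0 < p := by linarith
  rw [← integrable_norm_rpow_iff (measurable_weightedDeriv p s f).aestronglyMeasurable
    (by simpa using hp0) ENNReal.ofReal_ne_top, ENNReal.toReal_ofReal hp0.le]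
  exact integrableOn_congr_fun (fun z hz => (norm_weightedDeriv hp s f hz).symm)
    measurableSet_ball

theorem integral_rpow_eq {p : ℝ} (hp : 1 < p) {s : ℝ} {f : 𝔻 → ℂ}
    (hf : MemLp (weightedDeriv p s f) (ENNReal.ofReal p)
      (volume.restrict (Metric.ball (0 : ℂ) 1))) :
    (∫ z in Metric.ball (0 : ℂ) 1, dirichletIntegrand p s f z) ^ (1 / p) =
      (eLpNorm (weightedDeriv p s f) (ENNReal.ofReal p)
        (volume.restrict (Metric.ball (0 : ℂ) 1))).toReal := by
  have hp0 : 0 < p := by linarith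
  rw [hf.eLpNorm_eq_integral_rpow_norm (by simpa using hp0) ENNReal.ofReal_ne_top,
    ENNReal.toReal_ofReal hp0.le, ENNReal.toReal_ofReal (by positivity), one_div,
    setIntegral_congr_fun measurableSet_ball
      (fun z hz => (norm_weightedDeriv hp s f hz).symm)]

theorem weightedDeriv_add (p s : ℝ) {f g : 𝔻 → ℂ} (hf : IsHolo f) (hg : IsHolo g) :
    weightedDeriv p s (f + g) =ᵐ[volume.restrict (Metric.ball (0 : ℂ) 1)]
      weightedDeriv p s f + weightedDeriv p s g := by
  filter_upwards [ae_restrict_mem measurableSet_ball] with z hz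
  simp only [weightedDeriv, ext_add, Pi.add_apply,
    deriv_add (hf.differentiableAt hz) (hg.differentiableAt hz), mul_add]

theorem weightedDeriv_smul (p s : ℝ) (c : ℂ) (f : 𝔻 → ℂ) :
    weightedDeriv p s (c • f) = c • weightedDeriv p s f := by
  funext z
  simp only [weightedDeriv, ext_smul, Pi.smul_apply, smul_eq_mul, deriv_const_smul_field]
  ring

theorem IsHolo.add {f g : 𝔻 → ℂ} (hf : IsHolo f) (hg : IsHolo g) : IsHolo (f + g) := by
  rw [IsHolo, ext_add]; exact DifferentiableOn.add hf hg

theorem IsHolo.smul (c : ℂ) {f : 𝔻 → ℂ} (hf : IsHolo f) : IsHolo (c • f) := by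
  rw [IsHolo, ext_smul]; exact DifferentiableOn.const_smul hf c

/-- The functions in the weighted Dirichlet space `D^p_s`, as a linear subspace. -/
def dirichletSubmodule (p s : ℝ) [hp : Fact (1 < p)] : Submodule ℂ (𝔻 → ℂ) where
  carrier := {f | MemDirichlet p s f}
  zero_mem' := by
    refine ⟨by rw [IsHolo, ext_zero_fun]; exact differentiableOn_const 0, ?_⟩
    have hp0 : p ≠ 0 := by linarith [hp.out]
    have h0 : dirichletIntegrand p s 0 = 0 := by
      funext z; simp [dirichletIntegrand, ext_zero_fun, Real.zero_rpow hp0]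
    rw [h0]; exact integrableOn_zero
  add_mem' := by
    rintro f g ⟨hf, hf'⟩ ⟨hg, hg'⟩
    refine ⟨hf.add hg, ?_⟩
    rw [integrableOn_iff_memLp hp.out] at *
    exact (hf'.add hg').ae_eq (weightedDeriv_add p s hf hg).symm
  smul_mem' := by
    rintro c f ⟨hf, hf'⟩
    refine ⟨hf.smul c, ?_⟩
    rw [integrableOn_iff_memLp hp.out] at *
    rw [weightedDeriv_smul]; exact hf'.const_smul c

/-- The weighted Dirichlet space `D^p_s`; its topology is the one of `dirichletNorm`. -/
def DirichletSpace (p s : ℝ) [Fact (1 < p)] : Type :=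
  dirichletSubmodule p s

namespace DirichletSpace

variable {p s : ℝ} [hp : Fact (1 < p)]

instance : AddCommGroup (DirichletSpace p s) :=
  inferInstanceAs (AddCommGroup (dirichletSubmodule p s))

instance : Module ℂ (DirichletSpace p s) :=
  inferInstanceAs (Module ℂ (dirichletSubmodule p s))

instance : CoeFun (DirichletSpace p s) (fun _ => 𝔻 → ℂ) := ⟨fun f => f.1⟩

noncomputable instance : Norm (DirichletSpace p s) := ⟨fun f => dirichletNorm p s f.1⟩

theorem norm_eq (f : DirichletSpace p s) :
    ‖f‖ = ‖f.1 0‖ + (eLpNorm (weightedDeriv p s f.1) (ENNReal.ofReal p)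
      (volume.restrict (Metric.ball (0 : ℂ) 1))).toReal := by
  rw [← integral_rpow_eq hp.out ((integrableOn_iff_memLp hp.out s f.1).1 f.2.2)]
  rfl

theorem core : NormedSpace.Core ℂ (DirichletSpace p s) where
  norm_nonneg f := by rw [norm_eq]; positivity
  norm_smul c f := by
    have h1 : (c • f).1 = c • f.1 := rfl
    rw [norm_eq, norm_eq, h1, weightedDeriv_smul, eLpNorm_const_smul, Pi.smul_apply, norm_smul,
      ENNReal.toReal_mul, toReal_enorm, mul_add]
  norm_triangle f g := by
    have h1 : (f + g).1 = f.1 + g.1 := rfl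
    have hf := (integrableOn_iff_memLp hp.out s f.1).1 f.2.2
    have hg := (integrableOn_iff_memLp hp.out s g.1).1 g.2.2
    have hp1 : 1 ≤ ENNReal.ofReal p := by
      rw [← ENNReal.ofReal_one]; exact ENNReal.ofReal_le_ofReal hp.out.le
    have h2 := ENNReal.toReal_mono (ENNReal.add_ne_top.2 ⟨hf.eLpNorm_ne_top, hg.eLpNorm_ne_top⟩)
      (eLpNorm_add_le hf.1 hg.1 hp1)
    rw [ENNReal.toReal_add hf.eLpNorm_ne_top hg.eLpNorm_ne_top] at h2
    rw [norm_eq, norm_eq, norm_eq, h1, eLpNorm_congr_ae (weightedDeriv_add p s f.2.1 g.2.1),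
      Pi.add_apply]
    linarith [norm_add_le (f.1 0) (g.1 0)]
  norm_eq_zero_iff f := by
    have hL := (integrableOn_iff_memLp hp.out s f.1).1 f.2.2
    have hp0 : ENNReal.ofReal p ≠ 0 := by
      have : 0 < p := by linarith [hp.out]
      simpa using this
    constructor
    · intro h
      rw [norm_eq] at h
      have h0 : f.1 0 = 0 := by
        have := norm_nonneg (f.1 0)
        exact norm_eq_zero.1 (le_antisymm (by
          linarith [ENNReal.toReal_nonneg (a := eLpNorm (weightedDeriv p s f.1)
            (ENNReal.ofReal p) (volume.restrict (Metric.ball (0 : ℂ) 1)))]) this)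
      rw [h0, norm_zero, zero_add, ENNReal.toReal_eq_zero_iff] at h
      have h1 := (eLpNorm_eq_zero_iff hL.1 hp0).1 (h.resolve_right hL.eLpNorm_ne_top)
      have h2 : deriv (ext f.1) =ᵐ[volume.restrict (Metric.ball (0 : ℂ) 1)] 0 := by
        filter_upwards [h1, ae_restrict_mem measurableSet_ball] with z hz hzb
        have hw := (Real.rpow_pos_of_pos (weight_pos hzb) (s / p)).ne'
        simpa [weightedDeriv, Complex.ofReal_eq_zero, hw] using hz
      have h3 := Measure.eqOn_open_of_ae_eq h2 Metric.isOpen_ball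
        (DifferentiableOn.deriv f.2.1 Metric.isOpen_ball).continuousOn continuousOn_const
      apply Subtype.ext
      funext z
      have h4 := Metric.isOpen_ball.is_const_of_deriv_eq_zero
        (convex_ball (0 : ℂ) 1).isPreconnected f.2.1 h3
        (show (z : ℂ) ∈ _ by simpa using z.norm_lt_one)
        (show ((0 : 𝔻) : ℂ) ∈ _ by simp)
      rw [ext_coe, ext_coe, h0] at h4
      exact h4
    · rintro rfl
      have h1 : (0 : DirichletSpace p s).1 = 0 := rfl
      have h2 : weightedDeriv p s 0 = 0 := by
        funext z; simp [weightedDeriv, ext_zero_fun]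
      rw [norm_eq, h1, h2]; simp

noncomputable instance : NormedAddCommGroup (DirichletSpace p s) :=
  NormedAddCommGroup.ofCore (𝕜 := ℂ) core

noncomputable instance : NormedSpace ℂ (DirichletSpace p s) :=
  NormedSpace.ofCore core

end DirichletSpace

/-- The admissible range of the exponents, including the line `s = p - 2`, `p ≥ 2`, of the Besov
spaces and of the classical Dirichlet space (`p = 2`, `s = 0`). -/
def IsAdmissible (p s : ℝ) : Prop :=
  1 < p ∧ ((2 ≤ p ∧ p - 2 ≤ s) ∨ (p < 2 ∧ 0 ≤ s))

end HoloDisc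

namespace HoloDisc

open Metric Set
open scoped ComplexConjugate

/-! ### Möbius transformations and the Schwarz–Pick lemma -/

/-! Since `(f ∘ φ_t)' = (f' ∘ φ_t) φ_t'`, everything reduces to the operator `g ↦ (g ∘ Φ) Φ'` on the
weighted Bergman space of derivatives. The maps of a semigroup are univalent, so `|Φ'|²` is the
Jacobian of an injective change of variables.

For `p ≥ 2`, Schwarz–Pick absorbs the other factor `|Φ'|^(p-2)` into `(1 - |z|²)^(p-2)`, and the
remaining weight has exponent `s - (p - 2) ≥ 0`. For `p < 2`, the weighted arithmetic–geometric mean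
inequality gives `|Φ'|^p ≤ (p/2)|Φ'|² + (1 - p/2)`. The first term is again a change of variables;
the second is boundedness of `g ↦ g ∘ Φ`, which follows from Littlewood subordination. Both cases,
joined in `energy_comp_mul_deriv_le`, give the constant `((1 + |Φ 0|)/(1 - |Φ 0|))^(s+2)`. Bounded
point evaluations control the term `f (φ_t 0)` of the norm.

This constant tends to 1 as `t → 0⁺`, because `φ_t 0 → 0`. Together with pointwise convergence of
the derivatives it yields convergence in norm by a Fatou argument (`tendsto_lintegral_zero_of_le`),
so no dense subspace is needed. -/

/-- The automorphism `z ↦ (z - b) / (1 - b̄ z)` of the disc. -/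
noncomputable def mob (b z : ℂ) : ℂ := (z - b) / (1 - conj b * z)

/-- The constant `(1 + |b|) / (1 - |b|)` of the Schwarz–Pick estimates. -/
noncomputable def distortion (b : ℂ) : ℝ := (1 + ‖b‖) / (1 - ‖b‖)

theorem norm_conj_mul_lt_one {b z : ℂ} (hb : ‖b‖ < 1) (hz : ‖z‖ < 1) : ‖conj b * z‖ < 1 := by
  rw [norm_mul, RCLike.norm_conj]
  nlinarith [norm_nonneg b, norm_nonneg z]

theorem one_sub_conj_mul_ne_zero {b z : ℂ} (hb : ‖b‖ < 1) (hz : ‖z‖ < 1) :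
    1 - conj b * z ≠ 0 := by
  intro h
  have h1 := norm_conj_mul_lt_one hb hz
  rw [← sub_eq_zero.1 h, norm_one] at h1
  exact lt_irrefl _ h1

theorem norm_one_sub_conj_mul_le {b z : ℂ} (hz : ‖z‖ < 1) : ‖1 - conj b * z‖ ≤ 1 + ‖b‖ := by
  have h := norm_sub_le (1 : ℂ) (conj b * z)
  rw [norm_one, norm_mul, RCLike.norm_conj] at h
  nlinarith [norm_nonneg b, norm_nonneg z]

theorem le_norm_one_sub_conj_mul {b z : ℂ} (hz : ‖z‖ < 1) : 1 - ‖b‖ ≤ ‖1 - conj b * z‖ := by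
  have h := norm_sub_norm_le (1 : ℂ) (conj b * z)
  rw [norm_one, norm_mul, RCLike.norm_conj] at h
  nlinarith [norm_nonneg b, norm_nonneg z]

theorem norm_one_sub_conj_mul_sq_sub (b z : ℂ) :
    ‖1 - conj b * z‖ ^ 2 - ‖z - b‖ ^ 2 = (1 - ‖b‖ ^ 2) * (1 - ‖z‖ ^ 2) := by
  simp only [← Complex.normSq_eq_norm_sq, Complex.normSq_apply, Complex.sub_re, Complex.sub_im,
    Complex.mul_re, Complex.mul_im, Complex.conj_re, Complex.conj_im, Complex.one_re,
    Complex.one_im]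
  ring

theorem one_sub_norm_mob_sq {b z : ℂ} (hb : ‖b‖ < 1) (hz : ‖z‖ < 1) :
    1 - ‖mob b z‖ ^ 2 = (1 - ‖b‖ ^ 2) * (1 - ‖z‖ ^ 2) / ‖1 - conj b * z‖ ^ 2 := by
  have h := norm_pos_iff.2 (one_sub_conj_mul_ne_zero hb hz)
  rw [mob, norm_div, ← norm_one_sub_conj_mul_sq_sub, sub_div, div_self (by positivity), div_pow]

theorem norm_mob_lt_one {b z : ℂ} (hb : ‖b‖ < 1) (hz : ‖z‖ < 1) : ‖mob b z‖ < 1 := by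
  have h := norm_pos_iff.2 (one_sub_conj_mul_ne_zero hb hz)
  have h1 := one_sub_norm_mob_sq hb hz
  have h2 : 0 < (1 - ‖b‖ ^ 2) * (1 - ‖z‖ ^ 2) / ‖1 - conj b * z‖ ^ 2 := by
    have : 0 < 1 - ‖b‖ ^ 2 := by nlinarith [norm_nonneg b]
    have : 0 < 1 - ‖z‖ ^ 2 := by nlinarith [norm_nonneg z]
    positivity
  nlinarith [norm_nonneg (mob b z)]

theorem mapsTo_mob {b : ℂ} (hb : ‖b‖ < 1) : MapsTo (mob b) (ball 0 1) (ball 0 1) := by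
  intro z hz
  rw [mem_ball_zero_iff] at *
  exact norm_mob_lt_one hb hz

theorem hasDerivAt_mob {b z : ℂ} (hb : ‖b‖ < 1) (hz : ‖z‖ < 1) :
    HasDerivAt (mob b) ((1 - ‖b‖ ^ 2) / (1 - conj b * z) ^ 2) z := by
  have h := one_sub_conj_mul_ne_zero hb hz
  have h1 := ((hasDerivAt_id' z).sub_const b).div
    (((hasDerivAt_id' z).const_mul (conj b)).const_sub 1) h
  have h2 : conj b * b = (‖b‖ : ℂ) ^ 2 := Complex.conj_mul' b
  refine h1.congr_deriv ?_
  rw [← h2]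
  congr 1
  ring

theorem differentiableOn_mob {b : ℂ} (hb : ‖b‖ < 1) :
    DifferentiableOn ℂ (mob b) (ball 0 1) := fun _ hz =>
  (hasDerivAt_mob hb (mem_ball_zero_iff.1 hz)).differentiableAt.differentiableWithinAt

@[simp] theorem mob_self (b : ℂ) : mob b b = 0 := by simp [mob]

@[simp] theorem mob_zero_right (b : ℂ) : mob b 0 = -b := by simp [mob]

theorem mob_neg_mob {b z : ℂ} (hb : ‖b‖ < 1) (hz : ‖z‖ < 1) : mob (-b) (mob b z) = z := by
  have h := one_sub_conj_mul_ne_zero hb hz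
  have h' := one_sub_conj_mul_ne_zero hb hb
  have h1 : mob b z * (1 - conj b * z) = z - b := div_mul_cancel₀ _ h
  have h2 : 1 + conj b * mob b z ≠ 0 := by
    have := one_sub_conj_mul_ne_zero (b := -b) (by simpa) (norm_mob_lt_one hb hz)
    simpa using this
  have h3 : mob (-b) (mob b z) = (mob b z + b) / (1 + conj b * mob b z) := by simp [mob]
  rw [h3, div_eq_iff h2]
  linear_combination h1

theorem injOn_mob {b : ℂ} (hb : ‖b‖ < 1) : InjOn (mob b) (ball 0 1) := by
  intro z hz w hw h
  rw [mem_ball_zero_iff] at hz hw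
  rw [← mob_neg_mob hb hz, h, mob_neg_mob hb hw]

theorem one_le_distortion {b : ℂ} (hb : ‖b‖ < 1) : 1 ≤ distortion b := by
  rw [distortion, le_div_iff₀ (by linarith)]
  linarith [norm_nonneg b]

/-- A holomorphic self-map of the disc, as a function on `ℂ`. -/
structure IsSelfMap (Φ : ℂ → ℂ) : Prop where
  diff : DifferentiableOn ℂ Φ (ball 0 1)
  maps : MapsTo Φ (ball 0 1) (ball 0 1)

theorem isSelfMap_mob {b : ℂ} (hb : ‖b‖ < 1) : IsSelfMap (mob b) :=
  ⟨differentiableOn_mob hb, mapsTo_mob hb⟩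

theorem IsSelfMap.comp {Φ Ψ : ℂ → ℂ} (hΦ : IsSelfMap Φ) (hΨ : IsSelfMap Ψ) :
    IsSelfMap (Φ ∘ Ψ) :=
  ⟨hΦ.diff.comp hΨ.diff hΨ.maps, hΦ.maps.comp hΨ.maps⟩

theorem IsSelfMap.norm_lt_one {Φ : ℂ → ℂ} (hΦ : IsSelfMap Φ) {z : ℂ} (hz : ‖z‖ < 1) :
    ‖Φ z‖ < 1 :=
  mem_ball_zero_iff.1 (hΦ.maps (mem_ball_zero_iff.2 hz))

theorem IsSelfMap.differentiableAt {Φ : ℂ → ℂ} (hΦ : IsSelfMap Φ) {z : ℂ} (hz : ‖z‖ < 1) :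
    DifferentiableAt ℂ Φ z :=
  hΦ.diff.differentiableAt (isOpen_ball.mem_nhds (mem_ball_zero_iff.2 hz))

theorem IsSelfMap.norm_le_norm {Φ : ℂ → ℂ} (hΦ : IsSelfMap Φ) (h0 : Φ 0 = 0) {z : ℂ}
    (hz : ‖z‖ < 1) : ‖Φ z‖ ≤ ‖z‖ :=
  Complex.norm_le_norm_of_mapsTo_ball hΦ.diff
    (hΦ.maps.mono_right ball_subset_closedBall) h0 hz

/-- The **Schwarz–Pick lemma**: holomorphic self-maps contract the pseudohyperbolic distance. -/
theorem IsSelfMap.norm_mob_le {Φ : ℂ → ℂ} (hΦ : IsSelfMap Φ) {a z : ℂ} (ha : ‖a‖ < 1)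
    (hz : ‖z‖ < 1) : ‖mob (Φ a) (Φ z)‖ ≤ ‖mob a z‖ := by
  -- Conjugating by automorphisms that move `a` and `Φ a` to 0 gives a self-map fixing 0; the
  -- Schwarz lemma is applied to it at `mob a z`.
  have h := ((isSelfMap_mob (hΦ.norm_lt_one ha)).comp hΦ).comp
    (isSelfMap_mob (b := -a) (by simpa))
  have h1 := h.norm_le_norm (by simp) (norm_mob_lt_one ha hz)
  simpa [mob_neg_mob ha hz] using h1

/-- The **Schwarz–Pick lemma** for the derivative. -/
theorem IsSelfMap.norm_deriv_mul_le {Φ : ℂ → ℂ} (hΦ : IsSelfMap Φ) {a : ℂ} (ha : ‖a‖ < 1) :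
    ‖deriv Φ a‖ * (1 - ‖a‖ ^ 2) ≤ 1 - ‖Φ a‖ ^ 2 := by
  have hb := hΦ.norm_lt_one ha
  have h := ((isSelfMap_mob hb).comp hΦ).comp (isSelfMap_mob (b := -a) (by simpa))
  have h0 : ((mob (Φ a) ∘ Φ) ∘ mob (-a)) 0 = 0 := by simp
  have h1 := Complex.norm_deriv_le_one_of_mapsTo_ball h.diff
    (by rw [h0]; exact h.maps.mono_right ball_subset_closedBall) one_pos
  have hm := hasDerivAt_mob (b := -a) (z := 0) (by simpa) (by simp)
  have e : mob (-a) 0 = a := by simp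
  have hd := ((hasDerivAt_mob hb hb).comp a (hΦ.differentiableAt ha).hasDerivAt)
  rw [(hd.comp_of_eq 0 hm e.symm).deriv] at h1
  have pa : 0 < 1 - ‖a‖ ^ 2 := by nlinarith [norm_nonneg a]
  have pb : 0 < 1 - ‖Φ a‖ ^ 2 := by nlinarith [norm_nonneg (Φ a)]
  have h2 : conj (Φ a) * Φ a = (‖Φ a‖ : ℂ) ^ 2 := Complex.conj_mul' _
  -- The outer factors of the chain rule are `1 / (1 - |Φ a|²)` and `1 - |a|²`, so the bound by 1 is
  -- the claim.
  have h3 : ((1 : ℂ) - ‖Φ a‖ ^ 2) / (1 - conj (Φ a) * Φ a) ^ 2 = ((1 - ‖Φ a‖ ^ 2 : ℝ) : ℂ)⁻¹ := by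
    have : ((1 : ℂ) - ‖Φ a‖ ^ 2) = ((1 - ‖Φ a‖ ^ 2 : ℝ) : ℂ) := by push_cast; rfl
    rw [h2, this]
    have h4 : ((1 - ‖Φ a‖ ^ 2 : ℝ) : ℂ) ≠ 0 := by exact_mod_cast pb.ne'
    field_simp
  have h5 : ((1 : ℂ) - ‖-a‖ ^ 2) / (1 - conj (-a) * 0) ^ 2 = ((1 - ‖a‖ ^ 2 : ℝ) : ℂ) := by
    push_cast; simp
  rw [h3, h5, norm_mul, norm_mul, norm_inv, Complex.norm_real, Complex.norm_real,
    Real.norm_of_nonneg pa.le, Real.norm_of_nonneg pb.le, mul_assoc, inv_mul_le_iff₀ pb] at h1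
  simpa using h1

/-- Schwarz–Pick with base point 0 bounds `1 - |z|²` by `1 - |mob (Φ 0) (Φ z)|²`. In the formula for
the latter the denominator is at least `(1 - |Φ 0|)²`. This comparison moves the weight from `z` to
`Φ z`. -/
theorem IsSelfMap.one_sub_norm_sq_le {Φ : ℂ → ℂ} (hΦ : IsSelfMap Φ) {z : ℂ} (hz : ‖z‖ < 1) :
    1 - ‖z‖ ^ 2 ≤ distortion (Φ 0) * (1 - ‖Φ z‖ ^ 2) := by
  have hb := hΦ.norm_lt_one (z := 0) (by simp)
  have hw := hΦ.norm_lt_one hz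
  have h1 := hΦ.norm_mob_le (a := 0) (by simp) hz
  have h2 : mob 0 z = z := by simp [mob]
  rw [h2] at h1
  have h3 := one_sub_norm_mob_sq hb hw
  have h4 := le_norm_one_sub_conj_mul (b := Φ 0) hw
  have h5 : 0 < 1 - ‖Φ 0‖ := by linarith
  have h6 : 0 ≤ 1 - ‖Φ z‖ ^ 2 := by nlinarith [norm_nonneg (Φ z)]
  have h7 : 1 - ‖z‖ ^ 2 ≤ 1 - ‖mob (Φ 0) (Φ z)‖ ^ 2 := by
    have := pow_le_pow_left₀ (norm_nonneg _) h1 2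
    linarith
  refine h7.trans ?_
  rw [h3]
  calc (1 - ‖Φ 0‖ ^ 2) * (1 - ‖Φ z‖ ^ 2) / ‖1 - conj (Φ 0) * Φ z‖ ^ 2
      ≤ (1 - ‖Φ 0‖ ^ 2) * (1 - ‖Φ z‖ ^ 2) / (1 - ‖Φ 0‖) ^ 2 := by
        have : 0 ≤ 1 - ‖Φ 0‖ ^ 2 := by nlinarith [norm_nonneg (Φ 0)]
        gcongr
    _ = distortion (Φ 0) * (1 - ‖Φ z‖ ^ 2) := by
        rw [distortion]; field_simp; ring

/-- Follows from `|1 - b̄ z| ≤ 1 + |b|`. It allows the Jacobian of an automorphism to be inserted in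
an integral at the cost of a constant. -/
theorem one_le_distortion_mul_norm_deriv_mob {b z : ℂ} (hb : ‖b‖ < 1) (hz : ‖z‖ < 1) :
    1 ≤ distortion b * ‖deriv (mob b) z‖ := by
  have h1 := norm_one_sub_conj_mul_le (b := b) hz
  have h2 := norm_pos_iff.2 (one_sub_conj_mul_ne_zero hb hz)
  have h3 : 0 < 1 - ‖b‖ ^ 2 := by nlinarith [norm_nonneg b]
  have h4 : ‖(1 : ℂ) - ‖b‖ ^ 2‖ = 1 - ‖b‖ ^ 2 := by
    have : ((1 : ℂ) - ‖b‖ ^ 2) = ((1 - ‖b‖ ^ 2 : ℝ) : ℂ) := by push_cast; rfl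
    rw [this, Complex.norm_real, Real.norm_of_nonneg h3.le]
  rw [(hasDerivAt_mob hb hz).deriv, norm_div, norm_pow, h4, distortion, div_mul_div_comm,
    one_le_div (by have : 0 < 1 - ‖b‖ := by linarith
                   positivity)]
  have h5 := pow_le_pow_left₀ h2.le h1 2
  have h6 : 0 < 1 - ‖b‖ := by linarith
  nlinarith [mul_le_mul_of_nonneg_left h5 h6.le]

/-- Holomorphic self-maps of the disc are uniformly equicontinuous on compact sets. -/
theorem IsSelfMap.norm_sub_le {Φ : ℂ → ℂ} (hΦ : IsSelfMap Φ) {a z : ℂ} (ha : ‖a‖ < 1)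
    (hz : ‖z‖ < 1) : ‖Φ z - Φ a‖ ≤ 2 * ‖mob a z‖ := by
  have h := hΦ.norm_mob_le ha hz
  have hz' := hΦ.norm_lt_one hz
  have ha' := hΦ.norm_lt_one ha
  have h2 := norm_pos_iff.2 (one_sub_conj_mul_ne_zero ha' hz')
  have h1 := norm_one_sub_conj_mul_le (b := Φ a) hz'
  rw [mob, norm_div, div_le_iff₀ h2] at h
  nlinarith [norm_nonneg (mob a z)]

end HoloDisc

namespace HoloDisc

open Metric Set Real

/-! ### Littlewood subordination on circles -/

/-- The real part of this kernel is the Poisson kernel, bounded below by `(R - |w|)/(R + |w|)`. -/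
theorem herglotzRieszKernel_re_nonneg {R : ℝ} {w ζ : ℂ} (hw : w ∈ ball (0 : ℂ) R)
    (hζ : ζ ∈ sphere (0 : ℂ) R) : 0 ≤ (herglotzRieszKernel 0 w ζ).re := by
  have h := le_re_herglotzRieszKernel hζ hw
  rw [← herglotzRieszKernel_def] at h
  refine le_trans ?_ h
  rw [mem_ball_iff_norm] at hw
  have := norm_nonneg (w - 0)
  exact div_nonneg (by linarith) (by linarith)

theorem continuousOn_re_herglotzRieszKernel {R : ℝ} (hR : 0 < R) {w : ℂ}
    (hw : w ∈ ball (0 : ℂ) R) :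
    ContinuousOn (Complex.re ∘ herglotzRieszKernel 0 w) (sphere 0 R) := by
  have h := continuousOn_herglotzRieszKernel_sphere hw
  rw [abs_of_pos hR] at h
  exact Complex.continuous_re.comp_continuousOn h

/-- `|g|^p` is bounded by its Poisson integral. -/
theorem norm_rpow_le_circleAverage {p R : ℝ} (hp : 1 < p) (hR : 0 < R) {g : ℂ → ℂ}
    (hg : DifferentiableOn ℂ g (closedBall 0 R)) {w : ℂ} (hw : w ∈ ball (0 : ℂ) R) :
    ‖g w‖ ^ p ≤
      circleAverage ((Complex.re ∘ herglotzRieszKernel 0 w) • fun ζ => ‖g ζ‖ ^ p) 0 R := by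
  set P := Complex.re ∘ herglotzRieszKernel 0 w with hP
  have hp0 : 0 < p := by linarith
  have hPc : ContinuousOn P (sphere 0 R) := continuousOn_re_herglotzRieszKernel hR hw
  have hgc : ContinuousOn g (sphere 0 R) := hg.continuousOn.mono sphere_subset_closedBall
  have hcl : DiffContOnCl ℂ g (ball 0 R) :=
    (hg.mono closure_ball_subset_closedBall).diffContOnCl
  have h1 := hcl.circleAverage_re_herglotzRieszKernel_smul hw
  -- The Poisson formula for the constant function 1.
  have h2 : circleAverage P 0 R = 1 := by
    have h := (diffContOnCl_const (𝕜 := ℂ) (c := (1 : ℝ) • (1 : ℂ))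
      (s := ball (0 : ℂ) R)).circleAverage_re_herglotzRieszKernel_smul hw
    have h3 : (Complex.re ∘ herglotzRieszKernel 0 w • fun _ : ℂ => (1 : ℝ) • (1 : ℂ)) =
        Complex.ofRealCLM ∘ P := by
      funext ζ; simp [P]
    rw [h3, Complex.ofRealCLM.circleAverage_comp_comm (hPc.circleIntegrable hR.le)] at h
    simpa using h
  set m := ‖g w‖ with hm
  have hm0 : 0 ≤ m := norm_nonneg _
  rcases hm0.eq_or_lt with hm00 | hm_pos
  · rw [← hm00, zero_rpow hp0.ne']
    refine circleAverage_nonneg_of_nonneg fun ζ hζ => ?_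
    rw [abs_of_pos hR] at hζ
    exact mul_nonneg (herglotzRieszKernel_re_nonneg hw hζ) (by positivity)
  have hi : ∀ u : ℂ → ℝ, ContinuousOn u (sphere 0 R) → CircleIntegrable u 0 R :=
    fun u hu => hu.circleIntegrable hR.le
  have h3 : m ≤ circleAverage (P • fun ζ => ‖g ζ‖) 0 R := by
    rw [hm, ← h1]
    unfold circleAverage
    rw [norm_smul, smul_eq_mul, Real.norm_of_nonneg (by positivity)]
    refine mul_le_mul_of_nonneg_left ?_ (by positivity)
    refine (intervalIntegral.norm_integral_le_integral_norm (by positivity)).trans_eq ?_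
    refine intervalIntegral.integral_congr fun θ _ => ?_
    have : 0 ≤ P (circleMap 0 R θ) :=
      herglotzRieszKernel_re_nonneg hw (circleMap_mem_sphere 0 hR.le θ)
    simp only [Pi.smul_apply', norm_smul, Real.norm_of_nonneg this, smul_eq_mul, ← hP]
  have hgp : ContinuousOn (fun ζ => ‖g ζ‖ ^ p) (sphere 0 R) :=
    hgc.norm.rpow_const fun _ _ => Or.inr hp0.le
  have hpq : p.HolderConjugate (p / (p - 1)) := Real.HolderConjugate.conjExponent hp
  -- Jensen's inequality by way of Young's: `m^(p-1) |g| ≤ |g|^p / p + (1 - 1/p) m^p`. Averaged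
  -- against `P` and combined with `h3`, the multiple of `m^p` on the right cancels all but `m^p /
  -- p` on the left.
  have h4 : circleAverage (m ^ (p - 1) • (P • fun ζ => ‖g ζ‖)) 0 R ≤
      circleAverage (p⁻¹ • (P • fun ζ => ‖g ζ‖ ^ p) + (m ^ p * (1 - p⁻¹)) • P) 0 R := by
    refine circleAverage_mono (hi _ (by fun_prop)) (hi _ (by fun_prop)) fun ζ hζ => ?_
    rw [abs_of_pos hR] at hζ
    have hPn := herglotzRieszKernel_re_nonneg hw hζ
    have hy := Real.young_inequality_of_nonneg (norm_nonneg (g ζ))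
      (rpow_nonneg hm0 (p - 1)) hpq
    rw [← rpow_mul hm0, show (p - 1) * (p / (p - 1)) = p by field_simp [sub_pos.2 hp |>.ne']] at hy
    have h5 : (p / (p - 1))⁻¹ = 1 - p⁻¹ := by
      linarith [hpq.inv_add_inv_eq_one]
    rw [div_eq_mul_inv, div_eq_mul_inv, h5] at hy
    have := mul_le_mul_of_nonneg_left hy hPn
    simp only [Pi.smul_apply, Pi.mul_apply, Pi.add_apply, smul_eq_mul, P, Function.comp_apply]
    linarith
  rw [circleAverage_smul, circleAverage_add (hi _ (by fun_prop)) (hi _ (by fun_prop)),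
    circleAverage_smul, circleAverage_smul, h2] at h4
  simp only [smul_eq_mul] at h3 h4 ⊢
  have h6 := mul_le_mul_of_nonneg_left h3 (rpow_nonneg hm0 (p - 1))
  have h7 : m ^ (p - 1) * m = m ^ p := by
    rw [← rpow_add_one hm_pos.ne']; ring_nf
  have h8 : m ^ p * p⁻¹ ≤
      p⁻¹ * circleAverage (P * fun ζ => ‖g ζ‖ ^ p) 0 R := by linarith
  rw [mul_comm] at h8
  exact le_of_mul_le_mul_left h8 (by positivity)

/-- The Poisson integral of `|g|^p` over the circle of radius `R` majorizes `|g|^p` and is the real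
part of a holomorphic `H`. The mean value property of `H ∘ ψ` gives `H (ψ 0) = H 0`, whose real part
is the mean of `|g|^p` at radius `R`. The gap `r < R` keeps `ψ` of the closed disc inside the open
disc where `H` is holomorphic. -/
theorem circleAverage_comp_le_of_lt {p r R : ℝ} (hp : 1 < p) (hr : 0 < r) (hrR : r < R)
    (hR1 : R < 1) {g ψ : ℂ → ℂ} (hg : DifferentiableOn ℂ g (ball 0 1)) (hψ : IsSelfMap ψ)
    (h0 : ψ 0 = 0) :
    circleAverage (fun z => ‖g (ψ z)‖ ^ p) 0 r ≤ circleAverage (fun z => ‖g z‖ ^ p) 0 R := by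
  have hR : 0 < R := hr.trans hrR
  have hp0 : 0 ≤ p := by linarith
  have hsub : closedBall (0 : ℂ) R ⊆ ball 0 1 := closedBall_subset_ball hR1
  have hsub' : closedBall (0 : ℂ) r ⊆ ball 0 1 := closedBall_subset_ball (hrR.trans hR1)
  have hgR := hg.mono hsub
  have hu : CircleIntegrable (fun ζ => ‖g ζ‖ ^ p) 0 R :=
    ((hgR.continuousOn.mono sphere_subset_closedBall).norm.rpow_const
      fun _ _ => Or.inr hp0).circleIntegrable hR.le
  set H : ℂ → ℂ := fun w =>
    circleAverage (fun ζ ↦ herglotzRieszKernel 0 w ζ • ((‖g ζ‖ ^ p : ℝ) : ℂ)) 0 R with hH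
  have hHre : ∀ w ∈ ball (0 : ℂ) R, (H w).re =
      circleAverage ((Complex.re ∘ herglotzRieszKernel 0 w) • fun ζ => ‖g ζ‖ ^ p) 0 R :=
    fun w hw => re_circleAverage_herglotzRieszKernel_smul hu hw
  have hHd : DifferentiableOn ℂ H (ball 0 R) := by
    refine differentiableOn_circleAverage_herglotzRieszKernel_smul ?_
    rw [CircleIntegrable, intervalIntegrable_iff] at hu ⊢
    exact Complex.ofRealCLM.integrable_comp hu
  have hmaps : MapsTo ψ (closedBall 0 r) (ball 0 R) := by
    intro z hz
    rw [mem_closedBall_zero_iff] at hz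
    rw [mem_ball_zero_iff]
    exact ((hψ.norm_le_norm h0 (by linarith)).trans hz).trans_lt hrR
  have hc : DifferentiableOn ℂ (H ∘ ψ) (closedBall 0 r) := hHd.comp (hψ.diff.mono hsub') hmaps
  have hmean : circleAverage (H ∘ ψ) 0 r = H 0 := by
    have h := (hc.mono closure_ball_subset_closedBall).diffContOnCl
    rw [← abs_of_pos hr] at h
    rw [h.circleAverage, Function.comp_apply, h0]
  have hcs : ContinuousOn (H ∘ ψ) (sphere 0 r) := hc.continuousOn.mono sphere_subset_closedBall
  have hci : CircleIntegrable (H ∘ ψ) 0 r := hcs.circleIntegrable hr.le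
  have hgψ : ContinuousOn (fun z => ‖g (ψ z)‖ ^ p) (sphere 0 r) :=
    ((hg.continuousOn.comp hψ.diff.continuousOn hψ.maps).mono
      (sphere_subset_closedBall.trans hsub')).norm.rpow_const fun _ _ => Or.inr hp0
  calc circleAverage (fun z => ‖g (ψ z)‖ ^ p) 0 r
      ≤ circleAverage (Complex.reCLM ∘ (H ∘ ψ)) 0 r := by
        refine circleAverage_mono (hgψ.circleIntegrable hr.le)
          ((Complex.reCLM.continuous.comp_continuousOn hcs).circleIntegrable hr.le) fun z hz => ?_
        rw [abs_of_pos hr] at hz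
        have hz' := hmaps (sphere_subset_closedBall hz)
        have := norm_rpow_le_circleAverage hp hR hgR hz'
        rwa [← hHre _ hz'] at this
    _ = (H 0).re := by
        rw [Complex.reCLM.circleAverage_comp_comm hci, hmean]; rfl
    _ = circleAverage (fun z => ‖g z‖ ^ p) 0 R := by
        rw [hHre 0 (mem_ball_self hR)]
        refine circleAverage_congr_sphere fun ζ hζ => ?_
        rw [abs_of_pos hR, mem_sphere_zero_iff_norm] at hζ
        have hζ0 : ζ ≠ 0 := by
          rintro rfl; simp at hζ; linarith
        simp [herglotzRieszKernel_def, div_self hζ0]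

/-- **Littlewood's subordination principle** on circles. -/
theorem circleAverage_comp_le {p r : ℝ} (hp : 1 < p) (hr : 0 < r) (hr1 : r < 1)
    {g ψ : ℂ → ℂ} (hg : DifferentiableOn ℂ g (ball 0 1)) (hψ : IsSelfMap ψ) (h0 : ψ 0 = 0) :
    circleAverage (fun z => ‖g (ψ z)‖ ^ p) 0 r ≤ circleAverage (fun z => ‖g z‖ ^ p) 0 r := by
  -- Circle means depend continuously on the radius, so the gap closes as `R → r⁺`.
  have hc : ContinuousOn (circleAverage (fun z => ‖g z‖ ^ p) 0) (Ico 0 1) := by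
    refine ContinuousOn.circleAverage ?_ fun r hr => hr.1
    refine ContinuousOn.rpow_const (hg.continuousOn.norm.mono fun z hz => ?_)
      fun _ _ => Or.inr (by linarith)
    have := (mem_ofPred.1 hz).2
    simpa using this
  have ht : Tendsto (circleAverage (fun z => ‖g z‖ ^ p) 0) (𝓝[>] r)
      (𝓝 (circleAverage (fun z => ‖g z‖ ^ p) 0 r)) := by
    refine (hc r ⟨hr.le, hr1⟩).mono_left ?_
    rw [nhdsWithin_le_iff, mem_nhdsGT_iff_exists_Ioo_subset]
    exact ⟨1, hr1, fun x hx => ⟨hr.le.trans hx.1.le, hx.2⟩⟩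
  refine ge_of_tendsto ht ?_
  filter_upwards [Ioo_mem_nhdsGT hr1] with R hR
  exact circleAverage_comp_le_of_lt hp hr hR.1 hR.2 hg hψ h0

/-! ### Polar coordinates on the disc -/

theorem lintegral_circleMap_eq {F : ℂ → ℝ} {r : ℝ} (hr : 0 < r)
    (hF : ContinuousOn F (sphere 0 r)) (h0 : ∀ z, 0 ≤ F z) :
    ∫⁻ θ in Ioo (-π) π, ENNReal.ofReal (F (circleMap 0 r θ)) =
      ENNReal.ofReal (2 * π * circleAverage F 0 r) := by
  have hπ : -π ≤ π := by linarith [pi_pos]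
  have h1 : 2 * π * circleAverage F 0 r = ∫ θ in -π..π, F (circleMap 0 r θ) := by
    rw [circleAverage_eq_integral_add (-π),
      intervalIntegral.integral_comp_add_right (fun θ => F (circleMap 0 r θ)), smul_eq_mul,
      mul_inv_cancel_left₀ (by positivity)]
    congr 1 <;> ring
  have hc : Continuous fun θ => F (circleMap 0 r θ) :=
    hF.comp_continuous (continuous_circleMap 0 r) (circleMap_mem_sphere 0 hr.le)
  rw [h1, intervalIntegral.integral_of_le hπ, integral_Ioc_eq_integral_Ioo,
    ofReal_integral_eq_lintegral_ofReal]
  · exact (hc.integrableOn_Icc).mono_set Ioo_subset_Icc_self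
  · exact Eventually.of_forall fun θ => h0 _

/-- The weight is kept apart from `F` because it is radial: inequalities between circle means then
integrate to inequalities over the disc. Lower integrals avoid any integrability assumption. -/
theorem lintegral_ball_eq_circleAverage {F : ℂ → ℝ} {v : ℝ → ℝ}
    (hF : ContinuousOn F (ball 0 1)) (h0 : ∀ z, 0 ≤ F z) (hv : Measurable v)
    (hv0 : ∀ r ∈ Ioo (0 : ℝ) 1, 0 ≤ v r) :
    ∫⁻ z in ball (0 : ℂ) 1, ENNReal.ofReal (F z * v ‖z‖) =
      ∫⁻ r in Ioo (0 : ℝ) 1, ENNReal.ofReal (r * v r * (2 * π * circleAverage F 0 r)) := by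
  set G : ℂ → ENNReal := (ball (0 : ℂ) 1).indicator fun z => ENNReal.ofReal (F z * v ‖z‖)
  have hGm : Measurable G := by
    have hFm : Measurable ((ball (0 : ℂ) 1).indicator F) := by
      classical
      rw [← piecewise_eq_indicator]
      exact hF.measurable_piecewise continuousOn_const measurableSet_ball
    have : G = (ball (0 : ℂ) 1).indicator
        fun z => ENNReal.ofReal ((ball (0 : ℂ) 1).indicator F z * v ‖z‖) := by
      refine indicator_congr fun z hz => ?_
      rw [indicator_of_mem hz]
    rw [this]
    exact ((hFm.mul (hv.comp measurable_norm)).ennreal_ofReal).indicator measurableSet_ball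
  have hsymm : ∀ q : ℝ × ℝ, Complex.polarCoord.symm q = circleMap 0 q.1 q.2 := by
    intro q
    rw [Complex.polarCoord_symm_apply, circleMap, zero_add, Complex.exp_mul_I]
    push_cast; rfl
  have hcm : Measurable fun q : ℝ × ℝ => circleMap 0 q.1 q.2 := circleMap.continuous.measurable
  rw [← lintegral_indicator measurableSet_ball, ← Complex.lintegral_comp_polarCoord_symm]
  simp_rw [hsymm]
  rw [polarCoord_target, Measure.volume_eq_prod, ← Measure.prod_restrict, lintegral_prod]
  swap
  · exact (measurable_fst.ennreal_ofReal.mul (hGm.comp hcm)).aemeasurable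
  rw [← Ioo_union_Ici_eq_Ioi (zero_lt_one' ℝ), lintegral_union measurableSet_Ici]
  swap
  · exact disjoint_left.2 fun x hx hx' => not_lt.2 hx' hx.2
  have h2 : ∫⁻ r in Ici (1 : ℝ), ∫⁻ θ in Ioo (-π) π,
      ENNReal.ofReal r • G (circleMap 0 r θ) = 0 := by
    rw [setLIntegral_congr_fun (g := fun _ => 0) measurableSet_Ici, lintegral_zero]
    intro r hr
    have hr0 : (0 : ℝ) ≤ r := zero_le_one.trans hr
    have : ∀ θ, G (circleMap 0 r θ) = 0 := fun θ =>
      indicator_of_notMem (by simpa [abs_of_nonneg hr0] using hr) _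
    simp [this]
  rw [h2, add_zero]
  refine setLIntegral_congr_fun measurableSet_Ioo fun r hr => ?_
  have hrv := mul_nonneg hr.1.le (hv0 r hr)
  have h3 : ∀ θ, ENNReal.ofReal r • G (circleMap 0 r θ) =
      ENNReal.ofReal (r * v r) * ENNReal.ofReal (F (circleMap 0 r θ)) := by
    intro θ
    have hm : circleMap 0 r θ ∈ ball (0 : ℂ) 1 := by simpa [abs_of_pos hr.1] using hr.2
    rw [show G (circleMap 0 r θ) = _ from indicator_of_mem hm _, smul_eq_mul,
      ← ENNReal.ofReal_mul hr.1.le, ← ENNReal.ofReal_mul hrv, norm_circleMap_zero,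
      abs_of_pos hr.1]
    congr 1; ring
  have hs : sphere (0 : ℂ) r ⊆ ball 0 1 := sphere_subset_ball hr.2
  change ∫⁻ θ in Ioo (-π) π, ENNReal.ofReal r • G (circleMap 0 r θ) = _
  rw [lintegral_congr h3, lintegral_const_mul' _ _ ENNReal.ofReal_ne_top,
    lintegral_circleMap_eq hr.1 (hF.mono hs) h0, ← ENNReal.ofReal_mul hrv]

end HoloDisc

namespace HoloDisc

open Metric Set

/-! ### Weighted energies under composition -/

/-- The integral `∫ |g|^p (1 - |z|²)^s dA` over the disc, possibly infinite. -/
noncomputable def energy (p s : ℝ) (g : ℂ → ℂ) : ENNReal :=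
  ∫⁻ z in ball (0 : ℂ) 1, ENNReal.ofReal (‖g z‖ ^ p * (1 - ‖z‖ ^ 2) ^ s)

theorem aemeasurable_energyDensity {p s : ℝ} {g : ℂ → ℂ} {μ : Measure ℂ} (hg : AEMeasurable g μ) :
    AEMeasurable (fun z => ENNReal.ofReal (‖g z‖ ^ p * (1 - ‖z‖ ^ 2) ^ s)) μ := by
  fun_prop

theorem energy_congr {p s : ℝ} {g h : ℂ → ℂ} (H : ∀ z, ‖z‖ < 1 → g z = h z) :
    energy p s g = energy p s h :=
  setLIntegral_congr_fun measurableSet_ball fun z hz => by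
    simp only [H z (mem_ball_zero_iff.1 hz)]

/-- Subordination on each circle, integrated against the radial weight; hence the constant 1 and no
condition on `s`. -/
theorem energy_comp_le_of_map_zero {p s : ℝ} (hp : 1 < p) {g ψ : ℂ → ℂ}
    (hg : DifferentiableOn ℂ g (ball 0 1)) (hψ : IsSelfMap ψ) (h0 : ψ 0 = 0) :
    energy p s (fun z => g (ψ z)) ≤ energy p s g := by
  have hp0 : 0 ≤ p := by linarith
  have hv : Measurable fun r : ℝ => (1 - r ^ 2) ^ s := by fun_prop
  have hw : ∀ r ∈ Ioo (0 : ℝ) 1, 0 ≤ (1 - r ^ 2) ^ s := fun r hr =>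
    Real.rpow_nonneg (by nlinarith [hr.1, hr.2]) _
  rw [energy, energy,
    lintegral_ball_eq_circleAverage (F := fun z => ‖g (ψ z)‖ ^ p) (v := fun r => (1 - r ^ 2) ^ s)
      ((hg.continuousOn.comp hψ.diff.continuousOn hψ.maps).norm.rpow_const fun _ _ => Or.inr hp0)
      (fun _ => by positivity) hv hw,
    lintegral_ball_eq_circleAverage (F := fun z => ‖g z‖ ^ p) (v := fun r => (1 - r ^ 2) ^ s)
      (hg.continuousOn.norm.rpow_const fun _ _ => Or.inr hp0) (fun _ => by positivity) hv hw]
  refine setLIntegral_mono' measurableSet_Ioo fun r hr => ENNReal.ofReal_le_ofReal ?_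
  have h1 := circleAverage_comp_le hp hr.1 hr.2 hg hψ h0
  have h2 := mul_nonneg hr.1.le (hw r hr)
  gcongr

/-- The real Jacobian of a holomorphic map, read off from the norm of `ℂ` over `ℝ`. -/
theorem det_restrictScalars_toSpanSingleton (c : ℂ) :
    ((ContinuousLinearMap.toSpanSingleton ℂ c).restrictScalars ℝ).det = ‖c‖ ^ 2 := by
  have h : LinearMap.det ((ContinuousLinearMap.toSpanSingleton ℂ c : ℂ →L[ℂ] ℂ) : ℂ →ₗ[ℂ] ℂ) = c := by
    rw [← LinearMap.det_toMatrix (Module.Basis.singleton Unit ℂ)]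
    simp [LinearMap.toMatrix_apply]
  rw [← Complex.normSq_eq_norm_sq, ← Algebra.norm_complex_apply, ← h,
    ← LinearMap.det_restrictScalars, h]
  rfl

/-- Change of variables for a univalent self-map of the disc. -/
theorem lintegral_norm_deriv_sq_mul_comp_le {Φ : ℂ → ℂ} (hΦ : IsSelfMap Φ)
    (hinj : InjOn Φ (ball 0 1)) (h : ℂ → ENNReal) :
    ∫⁻ z in ball (0 : ℂ) 1, ENNReal.ofReal (‖deriv Φ z‖ ^ 2) * h (Φ z) ≤
      ∫⁻ w in ball (0 : ℂ) 1, h w := by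
  have h1 := lintegral_image_eq_lintegral_abs_det_fderiv_mul volume
    (measurableSet_ball (x := (0 : ℂ)) (ε := 1))
    (f := Φ) (f' := fun z => (ContinuousLinearMap.toSpanSingleton ℂ (deriv Φ z)).restrictScalars ℝ)
    (fun z hz => ((hΦ.differentiableAt (mem_ball_zero_iff.1 hz)).hasDerivAt.hasFDerivAt.restrictScalars
      ℝ).hasFDerivWithinAt) hinj h
  simp only [det_restrictScalars_toSpanSingleton, abs_pow, abs_norm] at h1
  rw [← h1]
  exact lintegral_mono_set hΦ.maps.image_subset

theorem IsSelfMap.weight_rpow_le {Φ : ℂ → ℂ} (hΦ : IsSelfMap Φ) {z : ℂ} (hz : ‖z‖ < 1) {s : ℝ}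
    (hs : 0 ≤ s) :
    (1 - ‖z‖ ^ 2) ^ s ≤ distortion (Φ 0) ^ s * (1 - ‖Φ z‖ ^ 2) ^ s := by
  have h1 := one_le_distortion (hΦ.norm_lt_one (z := 0) (by simp))
  have h2 := weight_pos (mem_ball_zero_iff.2 hz)
  have h3 := weight_pos (mem_ball_zero_iff.2 (hΦ.norm_lt_one hz))
  rw [← Real.mul_rpow (by linarith) h3.le]
  exact Real.rpow_le_rpow h2.le (hΦ.one_sub_norm_sq_le hz) hs

/-- If `G` is dominated, up to a constant, by the pullback of an energy density under a univalent
self-map, then its integral is dominated by that energy. -/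
theorem lintegral_le_of_le_norm_deriv_sq {p s C : ℝ} (hC : 0 ≤ C) {Φ g : ℂ → ℂ} {G : ℂ → ℝ}
    (hΦ : IsSelfMap Φ) (hinj : InjOn Φ (ball 0 1))
    (hG : ∀ z, ‖z‖ < 1 →
      G z ≤ C * (‖deriv Φ z‖ ^ 2 * (‖g (Φ z)‖ ^ p * (1 - ‖Φ z‖ ^ 2) ^ s))) :
    ∫⁻ z in ball (0 : ℂ) 1, ENNReal.ofReal (G z) ≤ ENNReal.ofReal C * energy p s g := by
  calc ∫⁻ z in ball (0 : ℂ) 1, ENNReal.ofReal (G z)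
      ≤ ∫⁻ z in ball (0 : ℂ) 1, ENNReal.ofReal C * (ENNReal.ofReal (‖deriv Φ z‖ ^ 2) *
          ENNReal.ofReal (‖g (Φ z)‖ ^ p * (1 - ‖Φ z‖ ^ 2) ^ s)) := by
        refine setLIntegral_mono' measurableSet_ball fun z hz => ?_
        rw [← ENNReal.ofReal_mul (by positivity), ← ENNReal.ofReal_mul hC]
        exact ENNReal.ofReal_le_ofReal (hG z (mem_ball_zero_iff.1 hz))
    _ ≤ ENNReal.ofReal C * energy p s g := by
        rw [lintegral_const_mul' _ _ ENNReal.ofReal_ne_top]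
        gcongr
        exact lintegral_norm_deriv_sq_mul_comp_le hΦ hinj
          fun w => ENNReal.ofReal (‖g w‖ ^ p * (1 - ‖w‖ ^ 2) ^ s)

theorem distortion_neg (b : ℂ) : distortion (-b) = distortion b := by simp [distortion]

/-- In the exponent `s + 2`, the `s` comes from comparing weights and the 2 from inserting the
Jacobian `|mob'|²`. -/
theorem energy_comp_mob_le {p s : ℝ} (hs : 0 ≤ s) {g : ℂ → ℂ} {b : ℂ} (hb : ‖b‖ < 1) :
    energy p s (fun z => g (mob b z)) ≤ ENNReal.ofReal (distortion b ^ (s + 2)) * energy p s g := by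
  have hK := one_le_distortion hb
  have hK0 : 0 < distortion b := by linarith
  refine lintegral_le_of_le_norm_deriv_sq (by positivity) (isSelfMap_mob hb) (injOn_mob hb)
    fun z hz => ?_
  have h1 := (isSelfMap_mob hb).weight_rpow_le hz hs
  rw [mob_zero_right, distortion_neg] at h1
  have h2 := one_le_pow₀ (one_le_distortion_mul_norm_deriv_mob hb hz) (n := 2)
  have h3 := weight_pos (mem_ball_zero_iff.2 ((isSelfMap_mob hb).norm_lt_one hz))
  have h4 := Real.rpow_pos_of_pos h3 s
  have h5 := Real.rpow_pos_of_pos hK0 s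
  calc ‖g (mob b z)‖ ^ p * (1 - ‖z‖ ^ 2) ^ s
      ≤ ‖g (mob b z)‖ ^ p * (distortion b ^ s * (1 - ‖mob b z‖ ^ 2) ^ s) := by gcongr
    _ ≤ ‖g (mob b z)‖ ^ p * (distortion b ^ s * (1 - ‖mob b z‖ ^ 2) ^ s) *
          (distortion b * ‖deriv (mob b) z‖) ^ 2 := le_mul_of_one_le_right (by positivity) h2
    _ = _ := by
        rw [Real.rpow_add hK0, Real.rpow_two]; ring

/-- Composition operators on weighted Bergman spaces. -/
theorem energy_comp_le {p s : ℝ} (hp : 1 < p) (hs : 0 ≤ s) {g Φ : ℂ → ℂ}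
    (hg : DifferentiableOn ℂ g (ball 0 1)) (hΦ : IsSelfMap Φ) :
    energy p s (fun z => g (Φ z)) ≤
      ENNReal.ofReal (distortion (Φ 0) ^ (s + 2)) * energy p s g := by
  have hb : ‖Φ 0‖ < 1 := hΦ.norm_lt_one (by simp)
  have hb' : ‖-Φ 0‖ < 1 := by rwa [norm_neg]
  have hτ := isSelfMap_mob hb'
  have h1 := energy_comp_mob_le (p := p) (g := g) hs hb'
  -- With `b = Φ 0`, write `Φ = mob (-b) ∘ (mob b ∘ Φ)`. The inner map fixes 0 and costs nothing;
  -- only the automorphism contributes a constant.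
  have h2 := energy_comp_le_of_map_zero (s := s) hp (hg.comp hτ.diff hτ.maps)
    ((isSelfMap_mob hb).comp hΦ) (by simp)
  rw [distortion_neg] at h1
  refine le_trans (le_of_eq (energy_congr fun z hz => ?_)) (h2.trans h1)
  simp only [Function.comp_apply]
  rw [mob_neg_mob hb (hΦ.norm_lt_one hz)]

/-- Boundedness of point evaluations on weighted Bergman spaces. -/
theorem energy_const_le {p s : ℝ} (hp : 1 < p) (hs : 0 ≤ s) {g : ℂ → ℂ}
    (hg : DifferentiableOn ℂ g (ball 0 1)) {b : ℂ} (hb : ‖b‖ < 1) :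
    energy p s (fun _ => g b) ≤ ENNReal.ofReal (distortion b ^ (s + 2)) * energy p s g :=
  -- Point evaluation is composition with a constant self-map.
  energy_comp_le hp hs hg (Φ := fun _ => b)
    ⟨differentiableOn_const b, fun _ _ => mem_ball_zero_iff.2 hb⟩

theorem IsAdmissible.nonneg {p s : ℝ} (h : IsAdmissible p s) : 0 ≤ s := by
  obtain ⟨-, h | h⟩ := h <;> linarith [h.1, h.2]

/-- The weighted composition operator `g ↦ (g ∘ Φ) Φ'` of a univalent self-map, `p ≥ 2`. -/
theorem energy_comp_mul_deriv_le_of_two_le {p s : ℝ} (hp : 2 ≤ p) (hs : p - 2 ≤ s) {g Φ : ℂ → ℂ}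
    (hΦ : IsSelfMap Φ) (hinj : InjOn Φ (ball 0 1)) :
    energy p s (fun z => g (Φ z) * deriv Φ z) ≤
      ENNReal.ofReal (distortion (Φ 0) ^ (s + 2)) * energy p s g := by
  have hK := one_le_distortion (hΦ.norm_lt_one (z := 0) (by simp))
  have hK0 : 0 < distortion (Φ 0) := by linarith
  refine lintegral_le_of_le_norm_deriv_sq (by positivity) hΦ hinj fun z hz => ?_
  have hwz := weight_pos (mem_ball_zero_iff.2 hz)
  have hwΦ := weight_pos (mem_ball_zero_iff.2 (hΦ.norm_lt_one hz))
  have h1 := hΦ.weight_rpow_le hz (s := s - (p - 2)) (by linarith)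
  have h2 : (‖deriv Φ z‖ * (1 - ‖z‖ ^ 2)) ^ (p - 2) ≤ (1 - ‖Φ z‖ ^ 2) ^ (p - 2) :=
    Real.rpow_le_rpow (by positivity) (hΦ.norm_deriv_mul_le hz) (by linarith)
  have h3 : distortion (Φ 0) ^ (s - (p - 2)) ≤ distortion (Φ 0) ^ (s + 2) :=
    Real.rpow_le_rpow_of_exponent_le hK (by linarith)
  -- Two powers of `|Φ'|` are kept as the Jacobian; the other `p - 2` are paired with as many powers
  -- of the weight for Schwarz–Pick.
  have h4 : ‖deriv Φ z‖ ^ p = ‖deriv Φ z‖ ^ 2 * ‖deriv Φ z‖ ^ (p - 2) := by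
    rw [← Real.rpow_two, ← Real.rpow_add_of_nonneg (norm_nonneg _) zero_le_two (by linarith)]
    congr 1; ring
  have h5 : (1 - ‖z‖ ^ 2) ^ s = (1 - ‖z‖ ^ 2) ^ (p - 2) * (1 - ‖z‖ ^ 2) ^ (s - (p - 2)) := by
    rw [← Real.rpow_add hwz]; congr 1; ring
  have h6 : (1 - ‖Φ z‖ ^ 2) ^ s =
      (1 - ‖Φ z‖ ^ 2) ^ (p - 2) * (1 - ‖Φ z‖ ^ 2) ^ (s - (p - 2)) := by
    rw [← Real.rpow_add hwΦ]; congr 1; ring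
  have h7 := Real.rpow_pos_of_pos hwz (s - (p - 2))
  have h8 := Real.rpow_pos_of_pos hwΦ (s - (p - 2))
  have h9 := Real.rpow_pos_of_pos hwΦ (p - 2)
  rw [norm_mul, Real.mul_rpow (norm_nonneg _) (norm_nonneg _), h4, h5, h6]
  calc ‖g (Φ z)‖ ^ p * (‖deriv Φ z‖ ^ 2 * ‖deriv Φ z‖ ^ (p - 2)) *
        ((1 - ‖z‖ ^ 2) ^ (p - 2) * (1 - ‖z‖ ^ 2) ^ (s - (p - 2)))
      = ‖g (Φ z)‖ ^ p * ‖deriv Φ z‖ ^ 2 *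
        ((‖deriv Φ z‖ * (1 - ‖z‖ ^ 2)) ^ (p - 2) * (1 - ‖z‖ ^ 2) ^ (s - (p - 2))) := by
        rw [Real.mul_rpow (norm_nonneg _) hwz.le]; ring
    _ ≤ ‖g (Φ z)‖ ^ p * ‖deriv Φ z‖ ^ 2 * ((1 - ‖Φ z‖ ^ 2) ^ (p - 2) *
        (distortion (Φ 0) ^ (s + 2) * (1 - ‖Φ z‖ ^ 2) ^ (s - (p - 2)))) := by
        gcongr
        exact h1.trans (by gcongr)
    _ = _ := by ring

/-- The weighted composition operator `g ↦ (g ∘ Φ) Φ'` of a univalent self-map, `p < 2`. -/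
theorem energy_comp_mul_deriv_le_of_lt_two {p s : ℝ} (hp : 1 < p) (hp2 : p < 2) (hs : 0 ≤ s)
    {g Φ : ℂ → ℂ} (hg : DifferentiableOn ℂ g (ball 0 1)) (hΦ : IsSelfMap Φ)
    (hinj : InjOn Φ (ball 0 1)) :
    energy p s (fun z => g (Φ z) * deriv Φ z) ≤
      ENNReal.ofReal (distortion (Φ 0) ^ (s + 2)) * energy p s g := by
  have hK := one_le_distortion (hΦ.norm_lt_one (z := 0) (by simp))
  have hK0 : 0 < distortion (Φ 0) := by linarith
  have hq : 0 ≤ 1 - p / 2 := by linarith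
  have hpp : 0 ≤ p / 2 := by linarith
  set A := ENNReal.ofReal (distortion (Φ 0) ^ (s + 2)) * energy p s g with hA
  have h1 : ∫⁻ z in ball (0 : ℂ) 1, ENNReal.ofReal
      (‖g (Φ z)‖ ^ p * ‖deriv Φ z‖ ^ 2 * (1 - ‖z‖ ^ 2) ^ s) ≤ A := by
    refine lintegral_le_of_le_norm_deriv_sq (by positivity) hΦ hinj fun z hz => ?_
    have h2 := hΦ.weight_rpow_le hz hs
    have h3 : distortion (Φ 0) ^ s ≤ distortion (Φ 0) ^ (s + 2) :=
      Real.rpow_le_rpow_of_exponent_le hK (by linarith)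
    have h4 := Real.rpow_pos_of_pos (weight_pos (mem_ball_zero_iff.2 (hΦ.norm_lt_one hz))) s
    calc ‖g (Φ z)‖ ^ p * ‖deriv Φ z‖ ^ 2 * (1 - ‖z‖ ^ 2) ^ s
        ≤ ‖g (Φ z)‖ ^ p * ‖deriv Φ z‖ ^ 2 *
          (distortion (Φ 0) ^ (s + 2) * (1 - ‖Φ z‖ ^ 2) ^ s) := by
          gcongr
          exact h2.trans (by gcongr)
      _ = _ := by ring
  have h2 := energy_comp_le hp hs hg hΦ
  have hmeas : AEMeasurable (fun z => ENNReal.ofReal (1 - p / 2) *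
      ENNReal.ofReal (‖g (Φ z)‖ ^ p * (1 - ‖z‖ ^ 2) ^ s)) (volume.restrict (ball (0 : ℂ) 1)) := by
    exact (aemeasurable_energyDensity ((hg.continuousOn.comp hΦ.diff.continuousOn
      hΦ.maps).aemeasurable measurableSet_ball)).const_mul _
  calc energy p s (fun z => g (Φ z) * deriv Φ z)
      ≤ ∫⁻ z in ball (0 : ℂ) 1, (ENNReal.ofReal (p / 2) * ENNReal.ofReal
          (‖g (Φ z)‖ ^ p * ‖deriv Φ z‖ ^ 2 * (1 - ‖z‖ ^ 2) ^ s) +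
          ENNReal.ofReal (1 - p / 2) * ENNReal.ofReal (‖g (Φ z)‖ ^ p * (1 - ‖z‖ ^ 2) ^ s)) := by
        refine setLIntegral_mono' measurableSet_ball fun z hz => ?_
        have hw := Real.rpow_pos_of_pos (weight_pos hz) s
        rw [← ENNReal.ofReal_mul hpp, ← ENNReal.ofReal_mul hq,
          ← ENNReal.ofReal_add (by positivity) (by positivity)]
        refine ENNReal.ofReal_le_ofReal ?_
        -- The means of `|Φ'|²` and 1 with weights `p/2` and `1 - p/2`. Both resulting integrals are
        -- at most `A` and the weights add up to 1, so no constant is lost.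
        have h3 := Real.geom_mean_le_arith_mean2_weighted hpp hq
          (sq_nonneg ‖deriv Φ z‖) zero_le_one (by ring)
        rw [Real.one_rpow, mul_one, mul_one, ← Real.rpow_two, ← Real.rpow_mul (norm_nonneg _),
          show (2 : ℝ) * (p / 2) = p by ring, Real.rpow_two] at h3
        rw [norm_mul, Real.mul_rpow (norm_nonneg _) (norm_nonneg _)]
        calc ‖g (Φ z)‖ ^ p * ‖deriv Φ z‖ ^ p * (1 - ‖z‖ ^ 2) ^ s
            ≤ ‖g (Φ z)‖ ^ p * (p / 2 * ‖deriv Φ z‖ ^ 2 + (1 - p / 2)) * (1 - ‖z‖ ^ 2) ^ s := by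
              gcongr
          _ = _ := by ring
    _ ≤ ENNReal.ofReal (p / 2) * A + ENNReal.ofReal (1 - p / 2) * A := by
        rw [lintegral_add_right' _ hmeas, lintegral_const_mul' _ _ ENNReal.ofReal_ne_top,
          lintegral_const_mul' _ _ ENNReal.ofReal_ne_top]
        gcongr
        exact h2
    _ = A := by
        rw [← add_mul, ← ENNReal.ofReal_add hpp hq]
        simp

/-- The weighted composition operator `g ↦ (g ∘ Φ) Φ'` of a univalent self-map. -/
theorem energy_comp_mul_deriv_le {p s : ℝ} (hps : IsAdmissible p s)
    {g Φ : ℂ → ℂ} (hg : DifferentiableOn ℂ g (ball 0 1)) (hΦ : IsSelfMap Φ)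
    (hinj : InjOn Φ (ball 0 1)) :
    energy p s (fun z => g (Φ z) * deriv Φ z) ≤
      ENNReal.ofReal (distortion (Φ 0) ^ (s + 2)) * energy p s g := by
  obtain ⟨hp, h | h⟩ := hps
  · exact energy_comp_mul_deriv_le_of_two_le h.1 h.2 hΦ hinj
  · exact energy_comp_mul_deriv_le_of_lt_two hp h.1 h.2 hg hΦ hinj

/-! ### Convergence in the mean -/

/-- Convergence in the mean from pointwise convergence and convergence of the norms. -/
theorem tendsto_lintegral_zero_of_le {α ι : Type*} [MeasurableSpace α] {μ : Measure α}
    {l : Filter ι} [l.IsCountablyGenerated] {D U : ι → α → ENNReal} {V : α → ENNReal}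
    {c : ENNReal} {C : ι → ENNReal} (hc : c ≠ ⊤)
    (hD : ∀ i, AEMeasurable (D i) μ) (hU : ∀ i, AEMeasurable (U i) μ) (hV : AEMeasurable V μ)
    (hle : ∀ i, ∀ᵐ x ∂μ, D i x ≤ c * (U i x + V x)) (hVfin : ∫⁻ x, V x ∂μ ≠ ⊤)
    (hD0 : ∀ᵐ x ∂μ, Tendsto (fun i => D i x) l (𝓝 0))
    (hUV : ∀ᵐ x ∂μ, Tendsto (fun i => U i x) l (𝓝 (V x)))
    (hCU : ∀ i, ∫⁻ x, U i x ∂μ ≤ C i * ∫⁻ x, V x ∂μ) (hC : Tendsto C l (𝓝 1)) :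
    Tendsto (fun i => ∫⁻ x, D i x ∂μ) l (𝓝 0) := by
  rcases l.eq_or_neBot with rfl | hl
  · exact tendsto_bot
  set A := ∫⁻ x, V x ∂μ with hA
  -- `W` is nonnegative with pointwise limit `2cV`, so Fatou gives `liminf ∫ W ≥ L`. Since `∫ W + ∫
  -- D` is bounded by a quantity tending to `L`, nothing is left for `∫ D`.
  set W : ι → α → ENNReal := fun i x => c * (U i x + V x) - D i x with hW
  set L := c * (A + A) with hL
  have hLtop : L ≠ ⊤ := ENNReal.mul_ne_top hc (ENNReal.add_ne_top.2 ⟨hVfin, hVfin⟩)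
  have hWm : ∀ i, AEMeasurable (W i) μ := fun i => (((hU i).add hV).const_mul c).sub (hD i)
  have hsum : ∀ i, ∫⁻ x, W i x ∂μ + ∫⁻ x, D i x ∂μ ≤ c * (C i * A + A) := by
    intro i
    rw [← lintegral_add_left' (hWm i)]
    calc ∫⁻ x, (W i x + D i x) ∂μ = ∫⁻ x, c * (U i x + V x) ∂μ := by
          refine lintegral_congr_ae ?_
          filter_upwards [hle i] with x hx
          exact tsub_add_cancel_of_le hx
      _ = c * (∫⁻ x, U i x ∂μ + A) := by
          rw [lintegral_const_mul' _ _ hc, lintegral_add_right' _ hV]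
      _ ≤ c * (C i * A + A) := by gcongr; exact hCU i
  have hb : Tendsto (fun i => c * (C i * A + A)) l (𝓝 L) := by
    have h1 : Tendsto (fun i => C i * A) l (𝓝 (1 * A)) :=
      ENNReal.Tendsto.mul_const hC (Or.inl one_ne_zero)
    rw [one_mul] at h1
    exact ENNReal.Tendsto.const_mul (h1.add_const A) (Or.inr hc)
  have hlow : L ≤ liminf (fun i => ∫⁻ x, W i x ∂μ) l := by
    refine le_trans (le_of_eq ?_) (lintegral_liminf_le' hWm)
    calc L = ∫⁻ x, c * (V x + V x) ∂μ := by
          rw [lintegral_const_mul' _ _ hc, lintegral_add_right' _ hV]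
      _ = _ := by
          refine lintegral_congr_ae ?_
          filter_upwards [hD0, hUV, ae_lt_top' hV hVfin] with x h1 h2 h3
          have h4 : Tendsto (fun i => W i x) l (𝓝 (c * (V x + V x) - 0)) :=
            ENNReal.Tendsto.sub (ENNReal.Tendsto.const_mul (h2.add_const _) (Or.inr hc)) h1
              (Or.inr ENNReal.zero_ne_top)
          rw [h4.liminf_eq, tsub_zero]
  have hWt : Tendsto (fun i => ∫⁻ x, W i x ∂μ) l (𝓝 L) := by
    refine tendsto_of_le_liminf_of_limsup_le hlow ?_
    rw [← hb.limsup_eq]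
    exact limsup_le_limsup (Eventually.of_forall fun i => le_self_add.trans (hsum i))
  have hsub := ENNReal.Tendsto.sub hb hWt (Or.inl hLtop)
  rw [tsub_self] at hsub
  refine tendsto_of_tendsto_of_tendsto_of_le_of_le' tendsto_const_nhds hsub
    (Eventually.of_forall fun _ => zero_le) ?_
  filter_upwards [hb.eventually_lt_const (lt_top_iff_ne_top.2 hLtop)] with i hi
  exact ENNReal.le_sub_of_add_le_left ((le_self_add.trans (hsum i)).trans_lt hi).ne (hsum i)

/-- Convergence in the weighted Bergman space from pointwise convergence and convergence of the
norms. -/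
theorem tendsto_energy_sub_zero {p s : ℝ} (hp : 0 < p) {ι : Type*} {l : Filter ι}
    [l.IsCountablyGenerated] {h : ι → ℂ → ℂ} {g : ℂ → ℂ} {C : ι → ENNReal}
    (hh : ∀ i, AEMeasurable (h i) (volume.restrict (ball (0 : ℂ) 1)))
    (hg : AEMeasurable g (volume.restrict (ball (0 : ℂ) 1)))
    (hlim : ∀ z, ‖z‖ < 1 → Tendsto (fun i => h i z) l (𝓝 (g z)))
    (hfin : energy p s g ≠ ⊤) (hle : ∀ i, energy p s (h i) ≤ C i * energy p s g)
    (hC : Tendsto C l (𝓝 1)) :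
    Tendsto (fun i => energy p s (fun z => h i z - g z)) l (𝓝 0) := by
  -- The constant comes from `|a - b|^p ≤ (2 max(|a|, |b|))^p ≤ 2^p (|a|^p + |b|^p)`.
  refine tendsto_lintegral_zero_of_le (c := ENNReal.ofReal (2 ^ p))
    (U := fun i z => ENNReal.ofReal (‖h i z‖ ^ p * (1 - ‖z‖ ^ 2) ^ s))
    (V := fun z => ENNReal.ofReal (‖g z‖ ^ p * (1 - ‖z‖ ^ 2) ^ s)) (C := C)
    ENNReal.ofReal_ne_top (fun i => ?_) (fun i => ?_) (aemeasurable_energyDensity hg) (fun i => ?_) hfin ?_ ?_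
    hle hC
  · exact aemeasurable_energyDensity ((hh i).sub hg)
  · exact aemeasurable_energyDensity (hh i)
  · filter_upwards [ae_restrict_mem measurableSet_ball] with z hz
    have hw := Real.rpow_pos_of_pos (weight_pos hz) s
    rw [← ENNReal.ofReal_add (by positivity) (by positivity),
      ← ENNReal.ofReal_mul (by positivity)]
    refine ENNReal.ofReal_le_ofReal ?_
    rw [← add_mul, ← mul_assoc]
    gcongr
    set a := ‖h i z‖
    set b := ‖g z‖
    have ha : 0 ≤ a := norm_nonneg _
    have hb : 0 ≤ b := norm_nonneg _
    calc ‖h i z - g z‖ ^ p ≤ (2 * max a b) ^ p := by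
          refine Real.rpow_le_rpow (norm_nonneg _) ?_ hp.le
          linarith [norm_sub_le (h i z) (g z), le_max_left a b, le_max_right a b]
      _ = 2 ^ p * (max a b) ^ p := Real.mul_rpow zero_le_two (le_max_of_le_left ha)
      _ ≤ 2 ^ p * (a ^ p + b ^ p) := by
          gcongr
          rcases max_choice a b with h1 | h1 <;> rw [h1]
          · linarith [Real.rpow_nonneg hb p]
          · linarith [Real.rpow_nonneg ha p]
  · filter_upwards [ae_restrict_mem measurableSet_ball] with z hz
    have h1 := ((hlim z (mem_ball_zero_iff.1 hz)).sub_const (g z)).norm.rpow_const (p := p)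
      (Or.inr hp.le)
    have h2 := ENNReal.tendsto_ofReal (h1.mul_const ((1 - ‖z‖ ^ 2) ^ s))
    simpa [Real.zero_rpow hp.ne'] using h2
  · filter_upwards [ae_restrict_mem measurableSet_ball] with z hz
    have h1 := (hlim z (mem_ball_zero_iff.1 hz)).norm.rpow_const (p := p) (Or.inr hp.le)
    exact ENNReal.tendsto_ofReal (h1.mul_const ((1 - ‖z‖ ^ 2) ^ s))

end HoloDisc

namespace HoloDisc

open Metric Set

/-! ### Univalence of the maps of a semigroup -/

/-- A map of a semigroup, extended by zero to `ℂ`. -/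
noncomputable def extMap (φ : ℝ≥0 → 𝔻 → 𝔻) (t : ℝ≥0) : ℂ → ℂ := ext fun z => (φ t z : ℂ)

theorem extMap_coe (φ : ℝ≥0 → 𝔻 → 𝔻) (t : ℝ≥0) (z : 𝔻) : extMap φ t z = φ t z := ext_coe _ z

theorem ext_comp_eq (φ : ℝ≥0 → 𝔻 → 𝔻) (t : ℝ≥0) (f : 𝔻 → ℂ) {z : ℂ} (hz : ‖z‖ < 1) :
    ext (fun w => f (φ t w)) z = ext f (extMap φ t z) := by
  rw [show z = (Complex.UnitDisc.mk z hz : 𝔻) from rfl, ext_coe, extMap_coe, ext_coe]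

namespace IsHolomorphicSemigroup

variable {φ : ℝ≥0 → 𝔻 → 𝔻}

theorem isSelfMap (hφ : IsHolomorphicSemigroup φ) (t : ℝ≥0) : IsSelfMap (extMap φ t) where
  diff := hφ.holo t
  maps z hz := by
    rw [mem_ball_zero_iff] at *
    rw [show z = (Complex.UnitDisc.mk z hz : 𝔻) from rfl, extMap_coe]
    exact Complex.UnitDisc.norm_lt_one _

/-- Passing from compact subsets of `𝔻` to compact subsets of the ball in `ℂ` makes Weierstrass'
theorem on derivatives available. -/
theorem tendstoLocallyUniformlyOn (hφ : IsHolomorphicSemigroup φ) :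
    TendstoLocallyUniformlyOn (extMap φ) id (𝓝[>] 0) (ball 0 1) := by
  rw [tendstoLocallyUniformlyOn_iff_forall_isCompact isOpen_ball]
  intro K hK hKc
  have hr : K ⊆ range ((↑) : 𝔻 → ℂ) := fun z hz =>
    ⟨Complex.UnitDisc.mk z (mem_ball_zero_iff.1 (hK hz)), rfl⟩
  have hc : IsCompact (((↑) : 𝔻 → ℂ) ⁻¹' K) :=
    Complex.UnitDisc.isEmbedding_coe.isInducing.isCompact_preimage' hKc hr
  have h := hφ.tendsto _ hc
  rw [Metric.tendstoUniformlyOn_iff] at h ⊢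
  intro ε hε
  filter_upwards [h ε hε] with t ht z hz
  obtain ⟨w, rfl⟩ := hr hz
  rw [extMap_coe]
  exact ht w hz

theorem tendsto_extMap (hφ : IsHolomorphicSemigroup φ) {z : ℂ} (hz : ‖z‖ < 1) :
    Tendsto (fun t => extMap φ t z) (𝓝[>] 0) (𝓝 z) :=
  hφ.tendstoLocallyUniformlyOn.tendsto_at (mem_ball_zero_iff.2 hz)

theorem tendstoLocallyUniformlyOn_deriv (hφ : IsHolomorphicSemigroup φ) :
    TendstoLocallyUniformlyOn (fun t => deriv (extMap φ t)) (fun _ => 1) (𝓝[>] 0) (ball 0 1) := by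
  have h := hφ.tendstoLocallyUniformlyOn.deriv
    (Eventually.of_forall fun t => (hφ.isSelfMap t).diff) isOpen_ball
  rwa [deriv_id'] at h

theorem tendsto_deriv_extMap (hφ : IsHolomorphicSemigroup φ) {z : ℂ} (hz : ‖z‖ < 1) :
    Tendsto (fun t => deriv (extMap φ t) z) (𝓝[>] 0) (𝓝 1) :=
  hφ.tendstoLocallyUniformlyOn_deriv.tendsto_at (mem_ball_zero_iff.2 hz)

/-- Near each point of the disc the maps of the semigroup are injective for small times. -/
theorem exists_ball_eventually_injOn (hφ : IsHolomorphicSemigroup φ) (ζ : 𝔻) :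
    ∃ δ > 0, ∀ᶠ t in 𝓝[>] (0 : ℝ≥0), InjOn (extMap φ t) (ball (ζ : ℂ) δ) := by
  have hζ : (ζ : ℂ) ∈ ball (0 : ℂ) 1 := mem_ball_zero_iff.2 ζ.norm_lt_one
  obtain ⟨δ, hδ, hsub⟩ := nhds_basis_closedBall.mem_iff.1 (isOpen_ball.mem_nhds hζ)
  refine ⟨δ, hδ, ?_⟩
  have h := (tendstoLocallyUniformlyOn_iff_forall_isCompact isOpen_ball).1
    hφ.tendstoLocallyUniformlyOn_deriv _ hsub (isCompact_closedBall _ _)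
  rw [Metric.tendstoUniformlyOn_iff] at h
  filter_upwards [h (1 / 2) (by norm_num)] with t ht a ha b hb hab
  -- The difference between the map and the identity is 1/2-Lipschitz here, so two points with the
  -- same image satisfy `|b - a| ≤ |b - a| / 2`.
  have hd : ∀ x ∈ ball (ζ : ℂ) δ, HasDerivAt (fun x => extMap φ t x - x)
      (deriv (extMap φ t) x - 1) x := fun x hx =>
    ((hφ.isSelfMap t).differentiableAt
      (mem_ball_zero_iff.1 (hsub (ball_subset_closedBall hx)))).hasDerivAt.sub (hasDerivAt_id' x)
  have h1 := (convex_ball (ζ : ℂ) δ).norm_image_sub_le_of_norm_deriv_le (C := 1 / 2)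
    (fun x hx => (hd x hx).differentiableAt)
    (fun x hx => by
      rw [(hd x hx).deriv, ← dist_eq_norm, dist_comm]
      exact (ht x (ball_subset_closedBall hx)).le) ha hb
  rw [hab, sub_sub_sub_cancel_left, norm_sub_rev] at h1
  have h2 : ‖b - a‖ = 0 := by linarith [norm_nonneg (b - a)]
  exact (sub_eq_zero.1 (norm_eq_zero.1 h2)).symm

/-- Write `φ_t = φ_(t-h) ∘ φ_h`. Schwarz–Pick bounds the change from `φ_(t-h) z` to `φ_(t-h) (φ_h
z)` uniformly over all self-maps, so it is enough that `φ_h z → z`. -/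
theorem tendsto_left (hφ : IsHolomorphicSemigroup φ) {t : ℝ≥0} (ht : 0 < t) (z : 𝔻) :
    Tendsto (fun h => (φ (t - h) z : ℂ)) (𝓝[>] 0) (𝓝 (φ t z)) := by
  have h1 : Tendsto (fun h => mob z (extMap φ h z)) (𝓝[>] 0) (𝓝 0) := by
    have hc := (hasDerivAt_mob z.norm_lt_one z.norm_lt_one).continuousAt.tendsto.comp
      (hφ.tendsto_extMap z.norm_lt_one)
    rwa [mob_self] at hc
  rw [tendsto_iff_norm_sub_tendsto_zero]
  have h2 := (h1.norm.const_mul 2)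
  rw [norm_zero, mul_zero] at h2
  refine squeeze_zero' (Eventually.of_forall fun _ => norm_nonneg _) ?_ h2
  have hlt : ∀ᶠ h in 𝓝[>] (0 : ℝ≥0), h < t := nhdsWithin_le_nhds (gt_mem_nhds ht)
  filter_upwards [hlt] with h hh
  have h3 := (hφ.isSelfMap (t - h)).norm_sub_le z.norm_lt_one (φ h z).norm_lt_one
  rw [extMap_coe, extMap_coe, hφ.comp, add_tsub_cancel_of_le hh.le, norm_sub_rev] at h3
  rwa [extMap_coe]

/-- The maps of a semigroup are univalent. -/
theorem injective (hφ : IsHolomorphicSemigroup φ) (t : ℝ≥0) : Function.Injective (φ t) := by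
  intro z w hzw
  by_contra hne
  -- Orbits that merge stay merged. Right continuity shows that the infimum `t₀` of `S` lies in `S`,
  -- and `t₀ > 0` because `φ_0` is the identity. Just before `t₀` both orbits are near their common
  -- value, where `φ_h` is injective for small `h`, so they had already merged.
  set S := {t | φ t z = φ t w} with hS
  have hSne : S.Nonempty := ⟨t, hzw⟩
  have hup : ∀ a ∈ S, ∀ b, a ≤ b → b ∈ S := by
    intro a ha b hab
    have h1 : ∀ x, φ b x = φ (b - a) (φ a x) := fun x => by
      rw [hφ.comp, add_tsub_cancel_of_le hab]
    change φ b z = φ b w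
    rw [h1, h1, show φ a z = φ a w from ha]
  set t₀ := sInf S with ht₀
  have hgt : ∀ b, t₀ < b → b ∈ S := fun b hb => by
    obtain ⟨a, ha, hab⟩ := exists_lt_of_csInf_lt hSne hb
    exact hup a ha b hab.le
  have hmem : φ t₀ z = φ t₀ w := by
    have h1 := hφ.tendsto_extMap (φ t₀ z).norm_lt_one
    have h2 := hφ.tendsto_extMap (φ t₀ w).norm_lt_one
    rw [← Complex.UnitDisc.coe_inj]
    refine tendsto_nhds_unique_of_eventuallyEq h1 h2 ?_
    filter_upwards [self_mem_nhdsWithin] with h hh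
    rw [extMap_coe, extMap_coe, hφ.comp, hφ.comp,
      show φ (t₀ + h) z = φ (t₀ + h) w from hgt _ (lt_add_of_pos_right _ hh)]
  have hpos : 0 < t₀ := by
    rcases eq_or_lt_of_le (zero_le (a := t₀)) with h | h
    · rw [← h, hφ.zero, hφ.zero] at hmem
      exact absurd hmem hne
    · exact h
  obtain ⟨δ, hδ, hinj⟩ := hφ.exists_ball_eventually_injOn (φ t₀ z)
  have hz := (hφ.tendsto_left hpos z).eventually (ball_mem_nhds _ hδ)
  have hw := (hφ.tendsto_left hpos w).eventually (ball_mem_nhds _ hδ)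
  rw [← hmem] at hw
  have hlt : ∀ᶠ h in 𝓝[>] (0 : ℝ≥0), h < t₀ := nhdsWithin_le_nhds (gt_mem_nhds hpos)
  obtain ⟨h, h1, h2, h3, h4, h5⟩ :=
    (hinj.and (hz.and (hw.and (hlt.and self_mem_nhdsWithin)))).exists
  have h6 : φ (t₀ - h) z = φ (t₀ - h) w := by
    rw [← Complex.UnitDisc.coe_inj]
    refine h1 h2 h3 ?_
    rw [extMap_coe, extMap_coe, hφ.comp, hφ.comp, tsub_add_cancel_of_le h4.le, hmem]
  exact (tsub_lt_self hpos h5).not_ge (csInf_le (OrderBot.bddBelow S) h6)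

theorem injOn (hφ : IsHolomorphicSemigroup φ) (t : ℝ≥0) : InjOn (extMap φ t) (ball 0 1) := by
  intro z hz w hw h
  rw [mem_ball_zero_iff] at hz hw
  rw [show z = (Complex.UnitDisc.mk z hz : 𝔻) from rfl,
    show w = (Complex.UnitDisc.mk w hw : 𝔻) from rfl, extMap_coe, extMap_coe,
    Complex.UnitDisc.coe_inj] at h
  exact (Complex.UnitDisc.mk_inj hz hw).1 (hφ.injective t h)

end IsHolomorphicSemigroup

/-! ### The composition semigroup on the Dirichlet space -/

theorem IsHolo.differentiableOn_deriv {f : 𝔻 → ℂ} (hf : IsHolo f) :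
    DifferentiableOn ℂ (deriv (ext f)) (ball 0 1) :=
  DifferentiableOn.deriv hf isOpen_ball

theorem memDirichlet_iff {p s : ℝ} {f : 𝔻 → ℂ} :
    MemDirichlet p s f ↔ IsHolo f ∧ energy p s (deriv (ext f)) ≠ ⊤ := by
  refine and_congr_right fun hf => ?_
  have hm : AEStronglyMeasurable (dirichletIntegrand p s f)
      (volume.restrict (ball (0 : ℂ) 1)) := by
    have := measurable_deriv (ext f)
    unfold dirichletIntegrand
    exact Measurable.aestronglyMeasurable (by fun_prop)
  rw [IntegrableOn, Integrable, and_iff_right hm, hasFiniteIntegral_iff_ofReal, lt_top_iff_ne_top]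
  · rfl
  · filter_upwards [ae_restrict_mem measurableSet_ball] with z hz
    have := Real.rpow_pos_of_pos (weight_pos hz) s
    simp only [dirichletIntegrand, Pi.zero_apply]
    positivity

theorem DirichletSpace.norm_eq_energy {p s : ℝ} [Fact (1 < p)] (f : DirichletSpace p s) :
    ‖f‖ = ‖f.1 0‖ + (energy p s (deriv (ext f.1))).toReal ^ (1 / p) := by
  change ‖f.1 0‖ + _ = _
  rw [integral_eq_lintegral_of_nonneg_ae ?_ f.2.2.1]
  · rfl
  · filter_upwards [ae_restrict_mem measurableSet_ball] with z hz
    have := Real.rpow_pos_of_pos (weight_pos hz) s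
    simp only [dirichletIntegrand, Pi.zero_apply]
    positivity

/-! ### Bounded point evaluations. -/

theorem energy_const {p s : ℝ} (c : ℂ) :
    energy p s (fun _ => c) =
      ENNReal.ofReal (‖c‖ ^ p) * ∫⁻ z in ball (0 : ℂ) 1, ENNReal.ofReal ((1 - ‖z‖ ^ 2) ^ s) := by
  rw [← lintegral_const_mul' _ _ ENNReal.ofReal_ne_top, energy]
  exact lintegral_congr fun z => ENNReal.ofReal_mul (by positivity)

theorem lintegral_weight_ne_top {s : ℝ} (hs : 0 ≤ s) :
    ∫⁻ z in ball (0 : ℂ) 1, ENNReal.ofReal ((1 - ‖z‖ ^ 2) ^ s) ≠ ⊤ := by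
  refine ne_top_of_le_ne_top (measure_ball_lt_top (μ := volume) (x := (0 : ℂ)) (r := 1)).ne ?_
  rw [← setLIntegral_one]
  refine setLIntegral_mono' measurableSet_ball fun z hz => ?_
  rw [← ENNReal.ofReal_one]
  exact ENNReal.ofReal_le_ofReal
    (Real.rpow_le_one (weight_pos hz).le (by linarith [sq_nonneg ‖z‖]) hs)

theorem lintegral_weight_ne_zero (s : ℝ) :
    ∫⁻ z in ball (0 : ℂ) 1, ENNReal.ofReal ((1 - ‖z‖ ^ 2) ^ s) ≠ 0 := by
  rw [← pos_iff_ne_zero, setLIntegral_pos_iff (by fun_prop)]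
  have : Function.support (fun z : ℂ => ENNReal.ofReal ((1 - ‖z‖ ^ 2) ^ s)) ∩ ball 0 1 =
      ball 0 1 := by
    refine inter_eq_right.2 fun z hz => ?_
    have := Real.rpow_pos_of_pos (weight_pos hz) s
    simpa using this
  rw [this]
  exact measure_ball_pos _ _ one_pos

/-- Locally uniform boundedness of point evaluations on weighted Bergman spaces. -/
theorem exists_norm_le_energy {p s ρ : ℝ} (hp : 1 < p) (hs : 0 ≤ s) (hρ0 : 0 ≤ ρ) (hρ : ρ < 1) :
    ∃ M, 0 ≤ M ∧ ∀ g : ℂ → ℂ, DifferentiableOn ℂ g (ball 0 1) → energy p s g ≠ ⊤ →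
      ∀ w, ‖w‖ ≤ ρ → ‖g w‖ ≤ M * (energy p s g).toReal ^ (1 / p) := by
  set m := ∫⁻ z in ball (0 : ℂ) 1, ENNReal.ofReal ((1 - ‖z‖ ^ 2) ^ s) with hm
  have hm0 : 0 < m.toReal :=
    ENNReal.toReal_pos (lintegral_weight_ne_zero s) (lintegral_weight_ne_top hs)
  have hρ' : 0 < 1 - ρ := by linarith
  have hp0 : 0 < p := by linarith
  set K := ((1 + ρ) / (1 - ρ)) ^ (s + 2) with hK
  have hK0 : 0 ≤ K := by positivity
  -- The energy of the constant `g w` is `|g w|^p m`, and `K` bounds the constant in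
  -- `energy_const_le` throughout `|w| ≤ ρ`.
  refine ⟨(K / m.toReal) ^ (1 / p), by positivity, fun g hg hfin w hw => ?_⟩
  have hw1 : ‖w‖ < 1 := hw.trans_lt hρ
  have hd : 0 ≤ distortion w := zero_le_one.trans (one_le_distortion hw1)
  have h1 := energy_const_le hp hs hg hw1
  rw [energy_const, ← hm] at h1
  have h2 := ENNReal.toReal_mono (ENNReal.mul_ne_top ENNReal.ofReal_ne_top hfin) h1
  rw [ENNReal.toReal_mul, ENNReal.toReal_mul, ENNReal.toReal_ofReal (by positivity),
    ENNReal.toReal_ofReal (by positivity)] at h2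
  have h3 : distortion w ^ (s + 2) ≤ K := by
    refine Real.rpow_le_rpow hd ?_ (by linarith)
    unfold distortion
    gcongr
  have h4 : ‖g w‖ ^ p ≤ K / m.toReal * (energy p s g).toReal := by
    rw [div_mul_eq_mul_div, le_div_iff₀ hm0]
    exact h2.trans (by gcongr)
  rw [← Real.mul_rpow (by positivity) ENNReal.toReal_nonneg]
  calc ‖g w‖ = (‖g w‖ ^ p) ^ (1 / p) := by
        rw [← Real.rpow_mul (norm_nonneg _), mul_one_div_cancel hp0.ne', Real.rpow_one]
    _ ≤ _ := Real.rpow_le_rpow (by positivity) h4 (by positivity)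

/-- Boundedness of point evaluations on the Dirichlet space. -/
theorem exists_norm_sub_le_energy {p s : ℝ} (hp : 1 < p) (hs : 0 ≤ s) (b : 𝔻) :
    ∃ M, 0 ≤ M ∧ ∀ f : 𝔻 → ℂ, MemDirichlet p s f →
      ‖f b - f 0‖ ≤ M * (energy p s (deriv (ext f))).toReal ^ (1 / p) := by
  obtain ⟨M, hM, h⟩ := exists_norm_le_energy hp hs (norm_nonneg (b : ℂ)) b.norm_lt_one
  refine ⟨M, hM, fun f hf => ?_⟩
  rw [memDirichlet_iff] at hf
  have hsub : closedBall (0 : ℂ) ‖(b : ℂ)‖ ⊆ ball 0 1 := closedBall_subset_ball b.norm_lt_one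
  -- The mean value inequality turns the uniform bound for `f'` on this disc into one for `f b - f
  -- 0`.
  have h1 := (convex_closedBall (0 : ℂ) ‖(b : ℂ)‖).norm_image_sub_le_of_norm_deriv_le
    (fun x hx => hf.1.differentiableAt (hsub hx))
    (fun x hx => h _ hf.1.differentiableOn_deriv hf.2 x (mem_closedBall_zero_iff.1 hx))
    (mem_closedBall_self (norm_nonneg _)) (mem_closedBall_zero_iff.2 le_rfl)
  rw [← Complex.UnitDisc.coe_zero, ext_coe, ext_coe, Complex.UnitDisc.coe_zero, sub_zero] at h1
  refine h1.trans (mul_le_of_le_one_right (by positivity) b.norm_lt_one.le)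

/-! ### Boundedness and strong continuity of the composition operators. -/

namespace IsHolomorphicSemigroup

variable {φ : ℝ≥0 → 𝔻 → 𝔻}

theorem isHolo_comp (hφ : IsHolomorphicSemigroup φ) (t : ℝ≥0) {f : 𝔻 → ℂ} (hf : IsHolo f) :
    IsHolo fun z => f (φ t z) :=
  (DifferentiableOn.comp hf (hφ.isSelfMap t).diff (hφ.isSelfMap t).maps).congr fun _ hz =>
    ext_comp_eq φ t f (mem_ball_zero_iff.1 hz)

theorem deriv_ext_comp (hφ : IsHolomorphicSemigroup φ) (t : ℝ≥0) {f : 𝔻 → ℂ} (hf : IsHolo f)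
    {z : ℂ} (hz : ‖z‖ < 1) :
    deriv (ext fun w => f (φ t w)) z =
      deriv (ext f) (extMap φ t z) * deriv (extMap φ t) z := by
  have hz' := mem_ball_zero_iff.2 hz
  have h1 : ext (fun w => f (φ t w)) =ᶠ[𝓝 z] ext f ∘ extMap φ t := by
    filter_upwards [isOpen_ball.mem_nhds hz'] with w hw
    exact ext_comp_eq φ t f (mem_ball_zero_iff.1 hw)
  rw [h1.deriv_eq, deriv_comp z (hf.differentiableAt ((hφ.isSelfMap t).maps hz'))
    ((hφ.isSelfMap t).differentiableAt hz)]

theorem energy_deriv_ext_comp_le (hφ : IsHolomorphicSemigroup φ) {p s : ℝ}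
    (hps : IsAdmissible p s) (t : ℝ≥0) {f : 𝔻 → ℂ} (hf : IsHolo f) :
    energy p s (deriv (ext fun w => f (φ t w))) ≤
      ENNReal.ofReal (distortion (extMap φ t 0) ^ (s + 2)) * energy p s (deriv (ext f)) := by
  rw [energy_congr fun z hz => hφ.deriv_ext_comp t hf hz]
  exact energy_comp_mul_deriv_le hps hf.differentiableOn_deriv (hφ.isSelfMap t) (hφ.injOn t)

theorem memDirichlet_comp (hφ : IsHolomorphicSemigroup φ) {p s : ℝ} (hps : IsAdmissible p s)
    (t : ℝ≥0) {f : 𝔻 → ℂ} (hf : MemDirichlet p s f) : MemDirichlet p s fun z => f (φ t z) := by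
  rw [memDirichlet_iff] at hf ⊢
  exact ⟨hφ.isHolo_comp t hf.1, ne_top_of_le_ne_top
    (ENNReal.mul_ne_top ENNReal.ofReal_ne_top hf.2) (hφ.energy_deriv_ext_comp_le hps t hf.1)⟩

variable {p s : ℝ} [hp : Fact (1 < p)]

/-- The composition operator `f ↦ f ∘ φ_t` on the Dirichlet space, as a linear map. -/
noncomputable def compLinearMap (hφ : IsHolomorphicSemigroup φ) (hps : IsAdmissible p s)
    (t : ℝ≥0) : DirichletSpace p s →ₗ[ℂ] DirichletSpace p s where
  toFun f := ⟨fun z => f.1 (φ t z), hφ.memDirichlet_comp hps t f.2⟩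
  map_add' _ _ := rfl
  map_smul' _ _ := rfl

theorem exists_norm_compLinearMap_le (hφ : IsHolomorphicSemigroup φ) (hps : IsAdmissible p s)
    (t : ℝ≥0) :
    ∃ C, ∀ f : DirichletSpace p s, ‖hφ.compLinearMap hps t f‖ ≤ C * ‖f‖ := by
  obtain ⟨M, hM, h⟩ := exists_norm_sub_le_energy hp.out hps.nonneg (φ t 0)
  have hd : 0 ≤ distortion (extMap φ t 0) :=
    zero_le_one.trans (one_le_distortion ((hφ.isSelfMap t).norm_lt_one (by simp)))
  have hp0 : 0 < p := by linarith [hp.out]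
  set K := distortion (extMap φ t 0) ^ (s + 2) with hK
  have hK0 : 0 ≤ K := by positivity
  -- `1 + M` accounts for `f (φ_t 0)` and `K^(1/p)` for the derivative.
  refine ⟨1 + M + K ^ (1 / p), fun f => ?_⟩
  have hf := memDirichlet_iff.1 f.2
  have h1 := h f.1 f.2
  have h2 := ENNReal.toReal_mono (ENNReal.mul_ne_top ENNReal.ofReal_ne_top hf.2)
    (hφ.energy_deriv_ext_comp_le hps t hf.1)
  rw [ENNReal.toReal_mul, ENNReal.toReal_ofReal hK0] at h2
  have h3 := Real.rpow_le_rpow ENNReal.toReal_nonneg h2 (by positivity : 0 ≤ 1 / p)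
  rw [Real.mul_rpow hK0 ENNReal.toReal_nonneg] at h3
  rw [DirichletSpace.norm_eq_energy, DirichletSpace.norm_eq_energy]
  change ‖f.1 (φ t 0)‖ + (energy p s (deriv (ext fun w => f.1 (φ t w)))).toReal ^ (1 / p) ≤ _
  set E := (energy p s (deriv (ext f.1))).toReal ^ (1 / p)
  have hE : 0 ≤ E := by positivity
  have h4 : ‖f.1 (φ t 0)‖ ≤ ‖f.1 0‖ + ‖f.1 (φ t 0) - f.1 0‖ := by
    have := norm_add_le (f.1 0) (f.1 (φ t 0) - f.1 0)
    rwa [add_sub_cancel] at this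
  have h5 : 0 ≤ K ^ (1 / p) := by positivity
  nlinarith [norm_nonneg (f.1 0), mul_nonneg hM (norm_nonneg (f.1 0)),
    mul_nonneg h5 (norm_nonneg (f.1 0))]

/-- The composition operator `f ↦ f ∘ φ_t` on the Dirichlet space. -/
noncomputable def compCLM (hφ : IsHolomorphicSemigroup φ) (hps : IsAdmissible p s)
    (t : ℝ≥0) : DirichletSpace p s →L[ℂ] DirichletSpace p s :=
  (hφ.compLinearMap hps t).mkContinuousOfExistsBound (hφ.exists_norm_compLinearMap_le hps t)

theorem compCLM_apply (hφ : IsHolomorphicSemigroup φ) (hps : IsAdmissible p s)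
    (t : ℝ≥0) (f : DirichletSpace p s) (z : 𝔻) : hφ.compCLM hps t f z = f (φ t z) := rfl

theorem tendsto_energy_comp_sub (hφ : IsHolomorphicSemigroup φ) (hps : IsAdmissible p s)
    {f : 𝔻 → ℂ} (hf : MemDirichlet p s f) :
    Tendsto (fun t => energy p s fun z =>
      deriv (ext fun w => f (φ t w)) z - deriv (ext f) z) (𝓝[>] 0) (𝓝 0) := by
  rw [memDirichlet_iff] at hf
  refine tendsto_energy_sub_zero (by linarith [hp.out])
    (C := fun t => ENNReal.ofReal (distortion (extMap φ t 0) ^ (s + 2)))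
    (fun t => (measurable_deriv _).aemeasurable) (measurable_deriv _).aemeasurable
    (fun z hz => ?_) hf.2 (fun t => hφ.energy_deriv_ext_comp_le hps t hf.1) ?_
  · have h1 : ContinuousAt (deriv (ext f)) z := (hf.1.differentiableOn_deriv.differentiableAt
      (isOpen_ball.mem_nhds (mem_ball_zero_iff.2 hz))).continuousAt
    have h2 := (h1.tendsto.comp (hφ.tendsto_extMap hz)).mul (hφ.tendsto_deriv_extMap hz)
    rw [mul_one] at h2
    exact h2.congr fun t => (hφ.deriv_ext_comp t hf.1 hz).symm
  -- The bounds tend to 1 since `φ_t 0 → 0` and `distortion 0 = 1`.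
  · have h1 : ContinuousAt (fun b => distortion b ^ (s + 2)) 0 := by
      unfold distortion
      refine ContinuousAt.rpow_const (ContinuousAt.div (by fun_prop) (by fun_prop) (by simp)) ?_
      simp
    have h2 := ENNReal.tendsto_ofReal (h1.tendsto.comp (hφ.tendsto_extMap (z := 0) (by simp)))
    simpa [distortion, Function.comp_def] using h2

theorem isStronglyContinuousSemigroup_compCLM (hφ : IsHolomorphicSemigroup φ)
    (hps : IsAdmissible p s) :
    IsStronglyContinuousSemigroup (fun t => (hφ.compCLM hps t : DirichletSpace p s →L[ℂ] _)) where
  zero := by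
    refine ContinuousLinearMap.ext fun f => Subtype.ext (funext fun z => ?_)
    exact congrArg f.1 (hφ.zero z)
  add t u := by
    refine ContinuousLinearMap.ext fun f => Subtype.ext (funext fun z => ?_)
    -- Composition operators reverse the order: `C_t C_u f = f ∘ φ_u ∘ φ_t`.
    exact congrArg f.1 (hφ.comp u t z).symm
  tendsto f := by
    have hp0 : 0 < p := by linarith [hp.out]
    have hE : ∀ t, energy p s (deriv (ext (hφ.compCLM hps t f - f).1)) =
        energy p s fun z => deriv (ext fun w => f.1 (φ t w)) z - deriv (ext f.1) z := by
      intro t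
      refine energy_congr fun z hz => ?_
      have hz' := mem_ball_zero_iff.2 hz
      have h1 : (hφ.compCLM hps t f - f).1 = (fun w => f.1 (φ t w)) + (-1 : ℂ) • f.1 := by
        funext w
        change f.1 (φ t w) - f.1 w = f.1 (φ t w) + (-1 : ℂ) * f.1 w
        ring
      rw [h1, ext_add, ext_smul, deriv_add ((hφ.isHolo_comp t f.2.1).differentiableAt hz')
        ((f.2.1.differentiableAt hz').const_smul _), deriv_const_smul_field]
      simp [sub_eq_add_neg]
    have h1 := (ENNReal.tendsto_toReal ENNReal.zero_ne_top).comp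
      (hφ.tendsto_energy_comp_sub hps f.2)
    have h2 := h1.rpow_const (p := 1 / p) (Or.inr (by positivity))
    have h3 : Tendsto (fun t => ‖f.1 (φ t 0) - f.1 0‖) (𝓝[>] 0) (𝓝 0) := by
      have hc : ContinuousAt (ext f.1) 0 :=
        (f.2.1.differentiableAt (mem_ball_self one_pos)).continuousAt
      have h4 := hc.tendsto.comp (hφ.tendsto_extMap (z := 0) (by simp))
      have h5 := (h4.sub_const (ext f.1 0)).norm
      rw [sub_self, norm_zero] at h5
      refine h5.congr fun t => ?_
      rw [Function.comp_apply, ← Complex.UnitDisc.coe_zero, extMap_coe, ext_coe, ext_coe]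
    have h6 := h3.add h2
    rw [ENNReal.toReal_zero, Real.zero_rpow (by positivity), add_zero] at h6
    refine h6.congr fun t => ?_
    rw [DirichletSpace.norm_eq_energy, hE]
    rfl

end IsHolomorphicSemigroup

end HoloDisc

theorem mainTheorem9 (p s : ℝ) [Fact (1 < p)] (hps : HoloDisc.IsAdmissible p s)
    (φ : ℝ≥0 → 𝔻 → 𝔻) (hφ : HoloDisc.IsHolomorphicSemigroup φ) :
    ∃ T : ℝ≥0 → (HoloDisc.DirichletSpace p s →L[ℂ] HoloDisc.DirichletSpace p s),
      (∀ (t : ℝ≥0) (f : HoloDisc.DirichletSpace p s) (z : 𝔻), T t f z = f (φ t z)) ∧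
      HoloDisc.IsStronglyContinuousSemigroup T :=
  ⟨hφ.compCLM hps, hφ.compCLM_apply hps, hφ.isStronglyContinuousSemigroup_compCLM hps⟩
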